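/- **Setting.** Let $m, n$ be positive integers with $m \le n$ and let $U \subset \mathbf{R}^n$ be open. Let $\mathbf{G}(n,m)$ be the Grassmannian of $m$-dimensional linear subspaces of $\mathbf{R}^n$, and let $\mathscr{K}(X)$ be the space of continuous real-valued functions with compact support on $X$. An $m$-dimensional varifold $V \in \mathbf{V}_m(U)$ is a Radon measure over $U \times \mathbf{G}(n,m)$. Its weight $\|V\|$ is its image under the projection to $U$, and its first variation is $$\delta V(g) = \int \operatorname{trace}(Dg(x) \circ S_\natural)\, dV(x,S) \quad \text{for } g \in \mathscr{D}(U,\mathbf{R}^n),$$ where $S_\natural$ is the orthogonal projection onto $S$. The measure $\|\delta V\|$ is the largest Borel regular measure over $U$ such that $\|\delta V\|(G) = \sup\{\delta V(g) : \operatorname{spt} g \subset G,\ |g| \le 1\}$ for all open $G \subset U$. $\mathbf{RV}_m(U)$ denotes the rectifiable varifolds, i.e. those of the form $V = \sum_{i=1}^\infty c_i\, \mathbf{v}(E_i)$ with real $c_i > 0$ and $\mathscr{H}^m$ measurable sets $E_i \subset U$ that meet each compact subset of $U$ in an $(\mathscr{H}^m,m)$ rectifiable set, where $\mathbf{v}(E)(A)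 = \mathscr{H}^m\{x \in E : (x, \operatorname{Tan}^m(\mathscr{H}^m \llcorner E, x)) \in A\}$. Let $\mathscr{K}(X)^*$ be the dual of $\mathscr{K}(X)$ with its usual inductive limit locally convex topology. The strong topology on $\mathbf{V}_m(U) \subset \mathscr{K}(U\times\mathbf{G}(n,m))^*$ is that of uniform convergence on bounded subsets of $\mathscr{K}(U \times \mathbf{G}(n,m))$. A class $P \subset \mathbf{RV}_m(U)$ is *appropriate* if 1. $V + W \in P$ whenever $V, W \in P$; 2. for every $V \in P$, the density $\mathbf{\Theta}^m(\|V\|,x)$ exists and is at least $1$ for $\|V\|$ almost all $x$; 3. $P$ is closed in the strong topology. For $V \in P$ with $\|\delta V\|$ a Radon measure: * $V$ is *indecomposable with respect to $P$* if there is no $W \in P \setminus \{0\}$ with $V - W \in P\setminus\{0\}$ and $\|\delta V\| = \|\delta W\| + \|\delta(V-W)\|$. * $W \in P$ is a *component of $V$ with respect to $P$* if $W \ne 0$, $W \le V$, $\|\delta V\| = \|\delta W\| + \|\delta (V-W)\|$, and $W$ is indecomposable with respect to $P$. * A countable family $H \subset P$ with a map $\xi : H \to \{1,2,3,\dots\}$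 is a *decomposition of $V$ with respect to $P$* if each $W \in H$ is a component of $V$ with respect to $P$, $$\sum_{W \in H} \xi(W)\, W(k) = V(k) \quad \text{for all } k \in \mathscr{K}(U \times \mathbf{G}(n,m)),$$ and $$\sum_{W \in H} \xi(W)\, \|\delta W\|(f) = \|\delta V\|(f) \quad \text{for all } f \in \mathscr{K}(U).$$ **Theorem.** Suppose $m, n$ are positive integers, $m \leq n$, $U$ is an open subset of $\mathbf{R}^n$, $P \subset \mathbf{RV}_m(U)$ is appropriate, $V \in P$, and $\|\delta V\|$ is a Radon measure. Then there exists a decomposition of $V$ with respect to $P$. -/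

import Mathlib

open MeasureTheory Set Filter Topology TopologicalSpace
open scoped ENNReal NNReal Distributions CompactlySupported ContDiff Manifold

noncomputable section

/-- The Euclidean space `ℝⁿ`. -/
abbrev Eucl (n : ℕ) : Type := EuclideanSpace ℝ (Fin n)

/-! ### The Grassmannian `G(n, m)` -/

/-- The Grassmannian `G(n, m)` of `m`-dimensional linear subspaces of `ℝⁿ`. -/
def Gr (n m : ℕ) : Type := {S : Submodule ℝ (Eucl n) // Module.finrank ℝ S = m}

namespace Gr

variable {n m : ℕ}

/-- The orthogonal projection of `ℝⁿ` onto the subspace `S`. -/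
def proj (S : Gr n m) : Eucl n →L[ℝ] Eucl n := S.1.starProjection

theorem proj_injective : Function.Injective (proj : Gr n m → (Eucl n →L[ℝ] Eucl n)) := by
  intro S T h
  apply Subtype.ext
  have h' : S.1.starProjection = T.1.starProjection := h
  rw [← Submodule.range_starProjection S.1, ← Submodule.range_starProjection T.1, h']

/-- The usual topology of the Grassmannian: subspaces are close when their orthogonal projections
are. -/
instance : TopologicalSpace (Gr n m) := TopologicalSpace.induced proj inferInstance

instance : MeasurableSpace (Gr n m) := borel _

instance : BorelSpace (Gr n m) := ⟨rfl⟩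

theorem isEmbedding_proj : IsEmbedding (proj : Gr n m → (Eucl n →L[ℝ] Eucl n)) :=
  ⟨⟨rfl⟩, proj_injective⟩

theorem continuous_proj : Continuous (proj : Gr n m → (Eucl n →L[ℝ] Eucl n)) :=
  isEmbedding_proj.continuous

instance : T2Space (Gr n m) := isEmbedding_proj.t2Space

instance : SecondCountableTopology (Gr n m) :=
  have : SecondCountableTopology (Eucl n →L[ℝ] Eucl n) :=
    secondCountable_of_proper
  isEmbedding_proj.secondCountableTopology

theorem trace_starProjection (S : Submodule ℝ (Eucl n)) :
    LinearMap.trace ℝ (Eucl n) (S.starProjection : Eucl n →ₗ[ℝ] Eucl n) = Module.finrank ℝ S := by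
  apply LinearMap.IsProj.trace
  refine ⟨fun x => Submodule.starProjection_apply_mem S x, fun x hx => ?_⟩
  exact Submodule.starProjection_eq_self_iff.2 hx

theorem range_proj : range (proj : Gr n m → (Eucl n →L[ℝ] Eucl n)) =
    {p : Eucl n →L[ℝ] Eucl n | p * p = p ∧ star p = p ∧ LinearMap.trace ℝ (Eucl n) (p : Eucl n →ₗ[ℝ] Eucl n) = m} := by
  ext p
  constructor
  · rintro ⟨S, rfl⟩
    have h := isStarProjection_iff_eq_starProjection.2 ⟨S.1, inferInstance, rfl⟩
    refine ⟨h.isIdempotentElem, h.isSelfAdjoint, ?_⟩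
    rw [proj, trace_starProjection, S.2]
  · rintro ⟨h1, h2, h3⟩
    have hp : IsStarProjection p := ⟨h1, h2⟩
    obtain ⟨S, _, hS⟩ := isStarProjection_iff_eq_starProjection.1 hp
    subst hS
    rw [trace_starProjection] at h3
    exact ⟨⟨S, by exact_mod_cast h3⟩, rfl⟩

instance : CompactSpace (Gr n m) := by
  have hc : IsCompact (range (proj : Gr n m → (Eucl n →L[ℝ] Eucl n))) := by
    apply Metric.isCompact_of_isClosed_isBounded
    · rw [range_proj]
      refine IsClosed.inter (isClosed_eq (by fun_prop) (by fun_prop))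
        (IsClosed.inter (isClosed_eq ?_ continuous_id) (isClosed_eq ?_ (by fun_prop)))
      · exact (ContinuousLinearMap.adjoint (𝕜 := ℝ) (E := Eucl n) (F := Eucl n)).continuous
      · exact ((LinearMap.trace ℝ (Eucl n)).comp
        (ContinuousLinearMap.coeLM ℝ)).continuous_of_finiteDimensional
    · rw [isBounded_iff_forall_norm_le]
      refine ⟨1, ?_⟩
      rintro _ ⟨S, rfl⟩
      exact Submodule.starProjection_norm_le S.1
  exact ⟨isEmbedding_proj.isCompact_iff.2 (by rwa [image_univ])⟩

end Gr

/-! ### Total variation of a vector valued linear functional on test functions -/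

section TotalVariation

variable {n : ℕ} {U : Opens (Eucl n)}

/-- `sup {T(g) : g ∈ 𝓓(U, ℝⁿ), spt g ⊂ G, |g| ≤ 1}`. -/
def openVariation (T : 𝓓(U, Eucl n) →ₗ[ℝ] ℝ) (G : Set U) : ℝ≥0∞ :=
  ⨆ g : {g : 𝓓(U, Eucl n) // tsupport g ⊆ Subtype.val '' G ∧ ∀ x, ‖g x‖ ≤ 1},
    ENNReal.ofReal (T g.1)

theorem openVariation_empty (T : 𝓓(U, Eucl n) →ₗ[ℝ] ℝ) : openVariation T ∅ = 0 := by
  simp only [openVariation, ENNReal.iSup_eq_zero]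
  rintro ⟨g, hg, -⟩
  have : g = 0 := by
    ext1 x
    rw [image_empty, subset_empty_iff, tsupport_eq_empty_iff] at hg
    simp [hg]
  simp [this]

theorem openVariation_mono (T : 𝓓(U, Eucl n) →ₗ[ℝ] ℝ) ⦃G G' : Set U⦄ (h : G ⊆ G') :
    openVariation T G ≤ openVariation T G' := by
  refine iSup_le fun g => ?_
  exact le_iSup (fun g : {g : 𝓓(U, Eucl n) // tsupport g ⊆ Subtype.val '' G' ∧ ∀ x, ‖g x‖ ≤ 1} =>
    ENNReal.ofReal (T g.1)) ⟨g.1, g.2.1.trans (image_mono h), g.2.2⟩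

theorem le_openVariation (T : 𝓓(U, Eucl n) →ₗ[ℝ] ℝ) {G : Set U} (g : 𝓓(U, Eucl n))
    (h : tsupport g ⊆ Subtype.val '' G) (h1 : ∀ x, ‖g x‖ ≤ 1) :
    ENNReal.ofReal (T g) ≤ openVariation T G :=
  le_iSup (fun g : {g : 𝓓(U, Eucl n) // tsupport g ⊆ Subtype.val '' G ∧ ∀ x, ‖g x‖ ≤ 1} =>
    ENNReal.ofReal (T g.1)) ⟨g, h, h1⟩

theorem ofReal_sum_le_sum_ofReal {ι : Type*} (s : Finset ι) (f : ι → ℝ) :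
    ENNReal.ofReal (∑ i ∈ s, f i) ≤ ∑ i ∈ s, ENNReal.ofReal (f i) :=
  Finset.le_sum_of_subadditive _ ENNReal.ofReal_zero.le
    (fun _ _ => ENNReal.ofReal_add_le) s f

theorem exists_smul_testFunction (g : 𝓓(U, Eucl n)) (φ : Eucl n → ℝ)
    (hφ : ContDiff ℝ ((⊤ : ℕ∞) : WithTop ℕ∞) φ) :
    ∃ h : 𝓓(U, Eucl n), ∀ x, h x = φ x • g x := by
  have h1 : ContDiff ℝ ((⊤ : ℕ∞) : WithTop ℕ∞) (fun x => φ x • g x) :=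
    ContDiff.smul (𝕜' := ℝ) hφ (TestFunction.contDiff g)
  have h2 : HasCompactSupport (fun x => φ x • g x) :=
    HasCompactSupport.smul_left (f := φ) (f' := g) g.hasCompactSupport
  have h3 : tsupport (fun x => φ x • g x) ⊆ tsupport g := by
    refine closure_mono fun x hx => ?_
    rw [Function.mem_support] at hx ⊢
    intro h
    exact hx (by rw [h, smul_zero])
  exact ⟨TestFunction.mk _ h1 h2 (h3.trans g.tsupport_subset), fun _ => rfl⟩

theorem openVariation_iUnion_le (T : 𝓓(U, Eucl n) →ₗ[ℝ] ℝ) (G : ℕ → Set U)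
    (hG : ∀ i, IsOpen (G i)) : openVariation T (⋃ i, G i) ≤ ∑' i, openVariation T (G i) := by
  refine iSup_le ?_
  rintro ⟨g, hg, hg1⟩
  have hG' : ∀ i, IsOpen (Subtype.val '' (G i) : Set (Eucl n)) := fun i =>
    U.isOpen.isOpenMap_subtype_val _ (hG i)
  rw [image_iUnion] at hg
  obtain ⟨t, ht⟩ := g.hasCompactSupport.isCompact.elim_finite_subcover _ hG' hg
  have ht' : tsupport g ⊆ ⋃ i : t, (Subtype.val '' (G i) : Set (Eucl n)) := by
    refine ht.trans ?_
    intro x hx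
    simp only [mem_iUnion] at hx ⊢
    obtain ⟨i, hi, hx⟩ := hx
    exact ⟨⟨i, hi⟩, hx⟩
  obtain ⟨ρ, hρ⟩ := SmoothPartitionOfUnity.exists_isSubordinate 𝓘(ℝ, Eucl n)
    (isClosed_tsupport g) (fun i : t => (Subtype.val '' (G i) : Set (Eucl n)))
    (fun i => hG' i) ht'
  choose gi hgi using fun i : t => exists_smul_testFunction g (ρ i) (ρ i).contMDiff.contDiff
  have hsum : g = ∑ i, gi i := by
    ext1 x
    have h1 : (∑ i, gi i) x = ∑ i, gi i x := by simp
    rw [h1]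
    simp only [hgi, ← Finset.sum_smul]
    by_cases hx : x ∈ tsupport g
    · have := ρ.sum_eq_one hx
      rw [finsum_eq_sum_of_fintype] at this
      rw [this, one_smul]
    · rw [image_eq_zero_of_notMem_tsupport hx, smul_zero]
  have hle : ∀ i, ENNReal.ofReal (T (gi i)) ≤ openVariation T (G i) := by
    intro i
    refine le_openVariation T _ ?_ fun x => ?_
    · have : (gi i : Eucl n → Eucl n) = fun x => ρ i x • g x := funext (hgi i)
      rw [this]
      exact (tsupport_smul_subset_left _ _).trans (hρ i)
    · rw [hgi, norm_smul]
      refine mul_le_one₀ ?_ (norm_nonneg _) (hg1 x)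
      rw [Real.norm_of_nonneg (ρ.nonneg i x)]
      exact ρ.le_one i x
  have hT : T g = ∑ i, T (gi i) := by
    conv_lhs => rw [hsum]
    exact map_sum T gi _
  change ENNReal.ofReal (T g) ≤ _
  rw [hT]
  refine (ofReal_sum_le_sum_ofReal _ _).trans ((Finset.sum_le_sum fun i _ => hle i).trans ?_)
  rw [Finset.sum_coe_sort t (fun i => openVariation T (G i))]
  exact ENNReal.sum_le_tsum t

/-- The outer measure `A ↦ inf {sup {T(g) : spt g ⊂ G, |g| ≤ 1} : A ⊂ G open}`. -/
def outerVariation (T : 𝓓(U, Eucl n) →ₗ[ℝ] ℝ) : OuterMeasure U :=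
  inducedOuterMeasure (fun (G : Set U) (_ : IsOpen G) => openVariation T G) isOpen_empty
    (openVariation_empty T)

theorem outerVariation_open (T : 𝓓(U, Eucl n) →ₗ[ℝ] ℝ) {G : Set U} (hG : IsOpen G) :
    outerVariation T G = openVariation T G :=
  inducedOuterMeasure_eq' (fun _ h => isOpen_iUnion h) (fun _ h => openVariation_iUnion_le T _ h)
    (fun _ _ _ _ h => openVariation_mono T h) hG

theorem openVariation_superadd (T : 𝓓(U, Eucl n) →ₗ[ℝ] ℝ) {G : Set U} (g h : 𝓓(U, Eucl n))
    (hg : tsupport g ⊆ Subtype.val '' G) (hg1 : ∀ x, ‖g x‖ ≤ 1)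
    (hh : tsupport h ⊆ Subtype.val '' G \ tsupport g) (hh1 : ∀ x, ‖h x‖ ≤ 1) :
    ENNReal.ofReal (T g) + ENNReal.ofReal (T h) ≤ openVariation T G := by
  have key : ∀ g h : 𝓓(U, Eucl n), tsupport g ⊆ Subtype.val '' G → (∀ x, ‖g x‖ ≤ 1) →
      tsupport h ⊆ Subtype.val '' G \ tsupport g → (∀ x, ‖h x‖ ≤ 1) →
      ENNReal.ofReal (T g + T h) ≤ openVariation T G := by
    intro g h hg hg1 hh hh1
    rw [← map_add]
    refine le_openVariation T _ ?_ fun x => ?_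
    · exact (tsupport_add _ _).trans (union_subset hg (hh.trans sdiff_subset))
    · have : (g + h) x = g x + h x := rfl
      rw [this]
      by_cases hx : x ∈ tsupport g
      · have : x ∉ tsupport h := fun hx' => (hh hx').2 hx
        rw [image_eq_zero_of_notMem_tsupport this, add_zero]
        exact hg1 x
      · rw [image_eq_zero_of_notMem_tsupport hx, zero_add]
        exact hh1 x
  rcases le_total 0 (T g) with h0 | h0
  · rcases le_total 0 (T h) with h0' | h0'
    · rw [← ENNReal.ofReal_add h0 h0']
      exact key g h hg hg1 hh hh1
    · rw [ENNReal.ofReal_of_nonpos h0', add_zero]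
      exact le_openVariation T g hg hg1
  · rw [ENNReal.ofReal_of_nonpos h0, zero_add]
    exact le_openVariation T h (hh.trans sdiff_subset) hh1

theorem borel_le_outerVariation (T : 𝓓(U, Eucl n) →ₗ[ℝ] ℝ) :
    (inferInstance : MeasurableSpace U) ≤ (outerVariation T).caratheodory := by
  rw [BorelSpace.measurable_eq (α := U)]
  refine MeasurableSpace.generateFrom_le fun s hs => ?_
  refine (inducedOuterMeasure_caratheodory (PU := fun _ h => isOpen_iUnion h)
    (msU := fun _ h => openVariation_iUnion_le T _ h)
    (m_mono := fun _ _ _ _ h => openVariation_mono T h) s).2 fun t ht => ?_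
  change outerVariation T (t ∩ s) + outerVariation T (t \ s) ≤ outerVariation T t
  have ho : IsOpen (t ∩ s) := IsOpen.inter ht hs
  have (G : Set U) :
      Nonempty {g : 𝓓(U, Eucl n) // tsupport g ⊆ Subtype.val '' G ∧ ∀ x, ‖g x‖ ≤ 1} := by
    refine ⟨0, ?_, ?_⟩
    · have : tsupport ((0 : 𝓓(U, Eucl n)) : Eucl n → Eucl n) = ∅ := tsupport_eq_empty_iff.2 rfl
      rw [this]
      exact empty_subset _
    · intro x
      have : (0 : 𝓓(U, Eucl n)) x = 0 := rfl
      rw [this, norm_zero]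
      exact zero_le_one
  rw [outerVariation_open T ht, outerVariation_open T ho, openVariation, ENNReal.iSup_add]
  refine iSup_le ?_
  rintro ⟨g, hg, hg1⟩
  set t' : Set U := t \ (Subtype.val ⁻¹' tsupport g) with ht'
  have hto : IsOpen t' :=
    IsOpen.sdiff ht ((isClosed_tsupport g).preimage continuous_subtype_val)
  have hsub : t \ s ⊆ t' := by
    rintro x ⟨hx, hxs⟩
    refine ⟨hx, fun hx' => hxs ?_⟩
    obtain ⟨y, hy, hyx⟩ := hg hx'
    rw [← Subtype.ext hyx]
    exact hy.2
  refine (add_le_add_right ((outerVariation T).mono hsub) _).trans ?_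
  change _ + outerVariation T t' ≤ _
  rw [outerVariation_open T hto]
  conv_lhs => rw [openVariation, ENNReal.add_iSup]
  refine iSup_le ?_
  rintro ⟨h, hh, hh1⟩
  refine openVariation_superadd T g h (hg.trans (image_mono inter_subset_left)) hg1 ?_ hh1
  intro x hx
  obtain ⟨y, hy, rfl⟩ := hh hx
  exact ⟨⟨y, hy.1, rfl⟩, hy.2⟩

/-- The total variation `‖T‖`: the (largest) Borel measure over `U` with
`‖T‖(G) = sup {T(g) : g ∈ 𝓓(U, ℝⁿ), spt g ⊂ G, |g| ≤ 1}` for every open `G ⊂ U`. -/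
def totalVariation (T : 𝓓(U, Eucl n) →ₗ[ℝ] ℝ) : Measure U :=
  (outerVariation T).toMeasure (borel_le_outerVariation T)

theorem totalVariation_open (T : 𝓓(U, Eucl n) →ₗ[ℝ] ℝ) {G : Set U} (hG : IsOpen G) :
    totalVariation T G = openVariation T G := by
  rw [totalVariation, toMeasure_apply _ _ hG.measurableSet, outerVariation_open T hG]

theorem le_totalVariation (T : 𝓓(U, Eucl n) →ₗ[ℝ] ℝ) (ν : Measure U)
    (hν : ∀ G, IsOpen G → ν G = openVariation T G) : ν ≤ totalVariation T := by
  refine Measure.le_iff.2 fun A hA => ?_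
  rw [totalVariation, toMeasure_apply _ _ hA]
  have : ν.toOuterMeasure ≤ outerVariation T :=
    le_inducedOuterMeasure.2 fun G hG => (hν G hG).le
  exact this A

end TotalVariation

/-! ### Varifolds, weight and first variation -/

/-- An `m`-dimensional varifold in `U`: a Radon measure over `U × G(n, m)`.  (On this locally
compact, second countable space a Borel measure is Radon if and only if it is finite on compact
sets.) -/
structure Varifold (m : ℕ) {n : ℕ} (U : Opens (Eucl n)) where
  /-- The underlying Borel measure. -/
  toMeasure : Measure (U × Gr n m)
  isRadon : IsFiniteMeasureOnCompacts toMeasure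

namespace Varifold

variable {m n : ℕ} {U : Opens (Eucl n)}

instance (V : Varifold m U) : IsFiniteMeasureOnCompacts V.toMeasure := V.isRadon

instance : Zero (Varifold m U) := ⟨⟨0, inferInstance⟩⟩

instance : Add (Varifold m U) :=
  ⟨fun V W => ⟨V.toMeasure + W.toMeasure,
    ⟨fun K hK => by
      rw [Measure.add_apply]
      exact ENNReal.add_lt_top.2 ⟨hK.measure_lt_top, hK.measure_lt_top⟩⟩⟩⟩

instance : LE (Varifold m U) := ⟨fun V W => V.toMeasure ≤ W.toMeasure⟩

/-- The weight `‖V‖` of a varifold: the image of `V` under the projection `U × G(n, m) → U`. -/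
def weight (V : Varifold m U) : Measure U := V.toMeasure.map Prod.fst

/-- The integrand `Dg(x) • S_♮ = trace (Dg(x) ∘ S_♮)` of the first variation, where `S_♮` is the
orthogonal projection onto `S`. -/
def tangentialDivergence (g : 𝓓(U, Eucl n)) (p : U × Gr n m) : ℝ :=
  LinearMap.trace ℝ (Eucl n) ((fderiv ℝ g p.1 ∘L p.2.proj : Eucl n →L[ℝ] Eucl n) :
    Eucl n →ₗ[ℝ] Eucl n)

theorem continuous_tangentialDivergence (g : 𝓓(U, Eucl n)) :
    Continuous (tangentialDivergence (m := m) g) := by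
  have h1 : Continuous (fderiv ℝ g) := g.contDiff.continuous_fderiv (by simp)
  have h2 : Continuous fun p : U × Gr n m => fderiv ℝ g p.1 ∘L p.2.proj :=
    (h1.comp (continuous_subtype_val.comp continuous_fst)).clm_comp
      (Gr.continuous_proj.comp continuous_snd)
  exact (((LinearMap.trace ℝ (Eucl n)).comp
    (ContinuousLinearMap.coeLM ℝ)).continuous_of_finiteDimensional).comp h2

theorem hasCompactSupport_tangentialDivergence (g : 𝓓(U, Eucl n)) :
    HasCompactSupport (tangentialDivergence (m := m) g) := by
  have hK : IsCompact ((Subtype.val ⁻¹' tsupport g : Set U) ×ˢ (univ : Set (Gr n m))) := by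
    refine IsCompact.prod ?_ isCompact_univ
    refine (IsEmbedding.subtypeVal.isCompact_iff).2 ?_
    have : (Subtype.val '' (Subtype.val ⁻¹' tsupport g : Set U) : Set (Eucl n)) = tsupport g := by
      rw [image_preimage_eq_iff, Subtype.range_val]
      exact g.tsupport_subset
    rw [this]
    exact g.hasCompactSupport
  refine HasCompactSupport.intro hK fun p hp => ?_
  have hp' : (p.1 : Eucl n) ∉ tsupport g := fun h => hp ⟨h, mem_univ _⟩
  have : fderiv ℝ g p.1 = 0 :=
    image_eq_zero_of_notMem_tsupport fun h => hp' (tsupport_fderiv_subset ℝ h)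
  simp [tangentialDivergence, this]

theorem integrable_tangentialDivergence (V : Varifold m U) (g : 𝓓(U, Eucl n)) :
    Integrable (tangentialDivergence g) V.toMeasure :=
  (continuous_tangentialDivergence g).integrable_of_hasCompactSupport
    (hasCompactSupport_tangentialDivergence g)

/-- The first variation `δV(g) = ∫ Dg(x) • S_♮ dV(x, S)` for `g ∈ 𝓓(U, ℝⁿ)`. -/
def firstVariation (V : Varifold m U) : 𝓓(U, Eucl n) →ₗ[ℝ] ℝ where
  toFun g := ∫ p, tangentialDivergence g p ∂V.toMeasure
  map_add' g h := by
    rw [← integral_add (V.integrable_tangentialDivergence g) (V.integrable_tangentialDivergence h)]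
    refine integral_congr_ae (Eventually.of_forall fun p => ?_)
    have : fderiv ℝ (g + h : 𝓓(U, Eucl n)) p.1 = fderiv ℝ g p.1 + fderiv ℝ h p.1 :=
      fderiv_add (g.contDiff.differentiable (by simp) _) (h.contDiff.differentiable (by simp) _)
    simp only [tangentialDivergence]
    rw [this, ContinuousLinearMap.add_comp, ContinuousLinearMap.toLinearMap_add, map_add]
  map_smul' c g := by
    rw [RingHom.id_apply, smul_eq_mul, ← integral_const_mul]
    refine integral_congr_ae (Eventually.of_forall fun p => ?_)
    have : fderiv ℝ (c • g : 𝓓(U, Eucl n)) p.1 = c • fderiv ℝ g p.1 :=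
      fderiv_const_smul (g.contDiff.differentiable (by simp) _) c
    simp only [tangentialDivergence]
    rw [this, ContinuousLinearMap.smul_comp, ContinuousLinearMap.toLinearMap_smul, map_smul,
      smul_eq_mul]

/-- The total variation measure `‖δV‖` of the first variation. -/
def variation (V : Varifold m U) : Measure U := totalVariation V.firstVariation

/-- `‖δV‖` is a Radon measure. -/
def HasRadonVariation (V : Varifold m U) : Prop := IsFiniteMeasureOnCompacts V.variation

end Varifold

/-! ### The strong topology -/

/-- The locally convex topology of the space `𝒦(X)` of continuous functions with compact support:
the finest locally convex topology for which the inclusion of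
`{f ∈ 𝒦(X) : spt f ⊂ K}`, with the supremum norm, is continuous for every compact `K ⊂ X`. -/
instance compactSupportTopology (X : Type*) [TopologicalSpace X] : TopologicalSpace C_c(X, ℝ) :=
  sInf {t | (∀ K : Set X, IsCompact K →
      @Continuous {f : C_c(X, ℝ) // tsupport f ⊆ K} C_c(X, ℝ)
        (TopologicalSpace.induced (fun f => f.1.toBoundedContinuousFunction) inferInstance) t
        Subtype.val) ∧
    @IsTopologicalAddGroup C_c(X, ℝ) t _ ∧ @ContinuousSMul ℝ C_c(X, ℝ) _ _ t ∧
    @LocallyConvexSpace ℝ C_c(X, ℝ) _ _ _ _ t}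

namespace Varifold

variable {m n : ℕ} {U : Opens (Eucl n)}

theorem integrable_compactSupport (V : Varifold m U) (f : C_c(U × Gr n m, ℝ)) :
    Integrable f V.toMeasure :=
  f.continuous.integrable_of_hasCompactSupport f.hasCompactSupport

/-- Integration against `V`, as a linear functional on `𝒦(U × G(n, m))`. -/
def integralLM (V : Varifold m U) : C_c(U × Gr n m, ℝ) →ₗ[ℝ] ℝ where
  toFun f := ∫ p, f p ∂V.toMeasure
  map_add' f g := integral_add (V.integrable_compactSupport f) (V.integrable_compactSupport g)
  map_smul' c f := integral_const_mul c f

theorem continuous_integralLM (V : Varifold m U) : Continuous V.integralLM := by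
  refine continuous_sInf_dom (t := TopologicalSpace.induced V.integralLM inferInstance) ?_
    continuous_induced_dom
  refine ⟨fun K hK => ?_, topologicalAddGroup_induced _, continuousSMul_induced _,
    LocallyConvexSpace.induced _⟩
  let : TopologicalSpace {f : C_c(U × Gr n m, ℝ) // tsupport f ⊆ K} :=
    TopologicalSpace.induced (fun f => f.1.toBoundedContinuousFunction) inferInstance
  rw [continuous_induced_rng]
  have : IsFiniteMeasure (V.toMeasure.restrict K) :=
    ⟨by rw [Measure.restrict_apply_univ]; exact hK.measure_lt_top⟩
  let L : BoundedContinuousFunction (U × Gr n m) ℝ →ₗ[ℝ] ℝ :=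
    { toFun := fun f => ∫ p, f p ∂(V.toMeasure.restrict K)
      map_add' := fun f g => integral_add (f.integrable _) (g.integrable _)
      map_smul' := fun c f => integral_const_mul c f }
  have hL : Continuous L :=
    AddMonoidHomClass.continuous_of_bound L ((V.toMeasure.restrict K).real univ) fun f =>
      f.norm_integral_le_mul_norm _
  have : (V.integralLM ∘ Subtype.val : {f : C_c(U × Gr n m, ℝ) // tsupport f ⊆ K} → ℝ) =
      L ∘ fun f => f.1.toBoundedContinuousFunction := by
    funext f
    refine (setIntegral_eq_integral_of_forall_compl_eq_zero fun p hp => ?_).symm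
    exact image_eq_zero_of_notMem_tsupport fun h => hp (f.2 h)
  rw [this]
  exact hL.comp (@continuous_induced_dom _ _ _ inferInstance)

/-- The Daniell integral on `𝒦(U × G(n, m))` given by a varifold, as an element of the dual space
`𝒦(U × G(n, m))*`. -/
def toDual (V : Varifold m U) : C_c(U × Gr n m, ℝ) →L[ℝ] ℝ :=
  ⟨V.integralLM, V.continuous_integralLM⟩

/-- The strong topology on varifolds, inherited from the dual `𝒦(U × G(n, m))*`.  The topology
that Mathlib puts on a space of continuous linear maps is that of uniform convergence on (von
Neumann) bounded subsets, so on the dual it is the strong topology. -/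
abbrev strongTopology (m : ℕ) {n : ℕ} (U : Opens (Eucl n)) : TopologicalSpace (Varifold m U) :=
  TopologicalSpace.induced toDual inferInstance

end Varifold

/-! ### Densities, approximate tangent planes, rectifiable varifolds -/

/-- `α(m)`, the volume of the unit ball of `ℝᵐ`. -/
def ballVolume (m : ℕ) : ℝ≥0∞ := volume (Metric.ball (0 : Eucl m) 1)

section Rectifiable

variable {n : ℕ} {U : Opens (Eucl n)}

/-- The `m`-dimensional density `Θᵐ(μ, x) = lim_{r → 0+} μ(B(x, r)) / (α(m) rᵐ)` exists
and equals `t`. -/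
def HasDensity (m : ℕ) (μ : Measure U) (x : U) (t : ℝ≥0∞) : Prop :=
  Tendsto (fun r : ℝ => μ (Metric.closedBall x r) / (ballVolume m * ENNReal.ofReal r ^ m))
    (𝓝[>] 0) (𝓝 t)

/-- The `m`-dimensional Hausdorff measure over `U`, with the normalisation
`α(m) 2⁻ᵐ diam(·)ᵐ` that gives Lebesgue measure for `m = n`. -/
def hausdorff (m : ℕ) (U : Opens (Eucl n)) : Measure U :=
  (ballVolume m / 2 ^ m) • Measure.hausdorffMeasure (m : ℝ)

/-- The tangent cone `Tan(S, a)`. -/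
def tanCone (S : Set U) (a : U) : Set (Eucl n) :=
  {v | ∀ ε > (0 : ℝ), ∃ y ∈ S, ∃ r > (0 : ℝ),
    ‖(y : Eucl n) - a‖ < ε ∧ ‖r • ((y : Eucl n) - a) - v‖ < ε}

/-- The cone `Tanᵐ(μ, a)` of `(μ, m)` approximate tangent vectors at `a`: the intersection of the
`Tan(S, a)` over all `S ⊂ U` with `Θᵐ(μ ⌞ (U ∖ S), a) = 0`. -/
def approxTanCone (m : ℕ) (μ : Measure U) (a : U) : Set (Eucl n) :=
  ⋂ (S : Set U) (_ : Tendsto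
    (fun r : ℝ => μ (Metric.closedBall a r \ S) / (ballVolume m * ENNReal.ofReal r ^ m))
    (𝓝[>] 0) (𝓝 0)), tanCone S a

/-- `E ⊂ U` is `ℋᵐ` measurable and meets every compact subset of `U` in an `(ℋᵐ, m)` rectifiable
set: it has locally finite `ℋᵐ` measure, and `ℋᵐ` almost all of it is covered by countably many
Lipschitz images of `ℝᵐ`. -/
structure IsRectifiableSet (m : ℕ) (E : Set U) : Prop where
  nullMeasurable : NullMeasurableSet E (hausdorff m U)
  locallyFinite : ∀ K : Set U, IsCompact K → hausdorff m U (E ∩ K) < ⊤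
  lipschitz_cover : ∃ f : ℕ → Eucl m → Eucl n, (∀ i, ∃ C : ℝ≥0, LipschitzWith C (f i)) ∧
    hausdorff m U (E \ ⋃ i, Subtype.val ⁻¹' range (f i)) = 0

/-- The value at `A ⊂ U × G(n, m)` of the varifold associated with a rectifiable set `E`:
`v(E)(A) = ℋᵐ {x ∈ E : (x, Tanᵐ(ℋᵐ ⌞ E, x)) ∈ A}`. -/
def setVarifold (m : ℕ) (E : Set U) (A : Set (U × Gr n m)) : ℝ≥0∞ :=
  hausdorff m U {x | x ∈ E ∧ ∃ S : Gr n m,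
    (S.1 : Set (Eucl n)) = approxTanCone m ((hausdorff m U).restrict E) x ∧ (x, S) ∈ A}

/-- `V` is a rectifiable varifold, `V ∈ RV_m(U)`: it is of the form `V = ∑ᵢ cᵢ v(Eᵢ)` with
positive real numbers `cᵢ` and rectifiable sets `Eᵢ` (which may be empty). -/
def Varifold.IsRectifiable {m : ℕ} (V : Varifold m U) : Prop :=
  ∃ (c : ℕ → ℝ) (E : ℕ → Set U), (∀ i, 0 < c i) ∧ (∀ i, IsRectifiableSet m (E i)) ∧
    ∀ A : Set (U × Gr n m), MeasurableSet A →
      V.toMeasure A = ∑' i, ENNReal.ofReal (c i) * setVarifold m (E i) A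

end Rectifiable

/-! ### Appropriate classes and decompositions -/

namespace Varifold

variable {m n : ℕ} {U : Opens (Eucl n)}

/-- A class `P ⊂ RV_m(U)` is appropriate if it is closed under addition, if
`Θᵐ(‖V‖, x) ≥ 1` for `‖V‖` almost all `x` whenever `V ∈ P`, and if it is closed in the
strong topology. -/
structure IsAppropriate (P : Set (Varifold m U)) : Prop where
  isRectifiable : ∀ V ∈ P, V.IsRectifiable
  add_mem : ∀ V ∈ P, ∀ W ∈ P, V + W ∈ P
  one_le_density : ∀ V ∈ P, ∀ᵐ x ∂V.weight, ∃ t : ℝ≥0∞, 1 ≤ t ∧ HasDensity m V.weight x t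
  isClosed : IsClosed[strongTopology m U] P

/-- `V` is indecomposable with respect to `P`: there is no `W ∈ P ∖ {0}` with
`X = V - W ∈ P ∖ {0}` and `‖δV‖ = ‖δW‖ + ‖δ(V - W)‖`. -/
def IsIndecomposable (P : Set (Varifold m U)) (V : Varifold m U) : Prop :=
  ¬ ∃ W ∈ P, ∃ X ∈ P, W ≠ 0 ∧ X ≠ 0 ∧ V = W + X ∧ V.variation = W.variation + X.variation

/-- `W` is a component of `V` with respect to `P`.  The varifold `X` in `splits` is `V - W`. -/
structure IsComponent (P : Set (Varifold m U)) (V W : Varifold m U) : Prop where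
  mem : W ∈ P
  ne_zero : W ≠ 0
  le : W ≤ V
  splits : ∃ X : Varifold m U, V = W + X ∧ V.variation = W.variation + X.variation
  isIndecomposable : IsIndecomposable P W

/-- The countable family `H` with multiplicities `ξ : H → {1, 2, 3, …}` is a decomposition of `V`
with respect to `P`. -/
structure IsDecomposition (P : Set (Varifold m U)) (V : Varifold m U) (H : Set (Varifold m U))
    (ξ : H → ℕ+) : Prop where
  countable : H.Countable
  isComponent : ∀ W ∈ H, IsComponent P V W
  hasSum : ∀ k : C_c(U × Gr n m, ℝ),
    HasSum (fun W : H => (ξ W : ℝ) * ∫ p, k p ∂W.1.toMeasure) (∫ p, k p ∂V.toMeasure)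
  hasSum_variation : ∀ f : C_c(U, ℝ),
    HasSum (fun W : H => (ξ W : ℝ) * ∫ x, f x ∂W.1.variation) (∫ x, f x ∂V.variation)

end Varifold

end

noncomputable section

/-! ### Total variation: regularity and comparison -/

section TotalVariation

/-! Indecomposable parts are peeled off `V` one at a time. The danger is that ever finer splitting
leaves nothing in the limit, or that the process never uses up `V`. A uniform lower mass bound
excludes both.

Let `A k` be the set of points at which `‖δV‖` of small balls is at most `k * r ^ m`. Outside the
union of the `A k` the upper density of `‖δV‖` is infinite, so a Vitali covering makes this set `ℋᵐ`
null (`hausdorffMeasure_eq_zero_of_frequently_lt`), hence `‖V‖` null by rectifiability. If `W ∈ P`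
satisfies `‖δW‖ ≤ ‖δV‖` and charges `A k`, then it has a point of density at least `1` there, and
the monotonicity inequality gives it mass at least `δ k > 0` in a fixed compact set
(`exists_mass_lower_bound`).

Given a residual that charges `A k`, a part charging `A k` whose mass in that compact set is within
`δ k` of the infimum cannot split into two parts that both charge `A k`. Inside it, successive
almost minimisation of a strictly positive finite functional converges to an indecomposable part
(`exists_isIndecomposable_of_unsplittable`). Such limits stay in `P`, because local convergence in
mass implies strong convergence, and they still split additively, because total variation is lower
semicontinuous.

If every `k` is treated infinitely often, each removal costs at least `δ k` of a finite mass, so the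
final residual charges no `A k` and vanishes (`exists_sequence_of_isIndecomposable`). Counting
repetitions in the resulting series yields `ξ`. -/

theorem MeasureTheory.Measure.le_of_forall_isOpen_le {X : Type*} [TopologicalSpace X]
    [MeasurableSpace X] {μ ν : Measure X} [ν.OuterRegular]
    (h : ∀ G, IsOpen G → μ G ≤ ν G) : μ ≤ ν := by
  refine Measure.le_iff.2 fun A _ => ?_
  rw [A.measure_eq_iInf_isOpen ν]
  exact le_iInf₂ fun G hAG => le_iInf fun hG => (measure_mono hAG).trans (h G hG)

/-- Half of the gap is allotted to each measure, and the two open sets are intersected. This allows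
comparison with `‖δV‖ + ‖δW‖` on open sets only. -/
instance MeasureTheory.Measure.OuterRegular.add {X : Type*} [TopologicalSpace X]
    [MeasurableSpace X] {μ ν : Measure X} [μ.OuterRegular] [ν.OuterRegular] :
    (μ + ν).OuterRegular := by
  refine ⟨fun A _ r hr => ?_⟩
  rw [gt_iff_lt, Measure.add_apply] at hr
  have hμ : μ A ≠ ⊤ := fun h => by simp [h] at hr
  have hν : ν A ≠ ⊤ := fun h => by simp [h] at hr
  obtain ⟨ε, hε, hlt⟩ : ∃ ε : ℝ≥0∞, ε ≠ 0 ∧ μ A + ν A + (ε + ε) ≤ r := by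
    refine ⟨(r - (μ A + ν A)) / 2, ?_, ?_⟩
    · exact (ENNReal.half_pos (tsub_pos_iff_lt.2 hr).ne').ne'
    · rw [ENNReal.add_halves, add_tsub_cancel_of_le hr.le]
  obtain ⟨G, hAG, hG, h1⟩ := A.exists_isOpen_lt_add (μ := μ) hμ hε
  obtain ⟨G', hAG', hG', h2⟩ := A.exists_isOpen_lt_add (μ := ν) hν hε
  refine ⟨G ∩ G', subset_inter hAG hAG', hG.inter hG', ?_⟩
  rw [Measure.add_apply]
  calc μ (G ∩ G') + ν (G ∩ G') ≤ μ G + ν G' :=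
        add_le_add (measure_mono inter_subset_left) (measure_mono inter_subset_right)
    _ < (μ A + ε) + (ν A + ε) := ENNReal.add_lt_add h1 h2
    _ = μ A + ν A + (ε + ε) := by ring
    _ ≤ r := hlt

variable {n : ℕ} {U : Opens (Eucl n)}

instance (T : 𝓓(U, Eucl n) →ₗ[ℝ] ℝ) : (totalVariation T).OuterRegular := by
  refine ⟨fun A hA r hr => ?_⟩
  rw [gt_iff_lt, totalVariation, toMeasure_apply _ _ hA, outerVariation,
    inducedOuterMeasure_eq_iInf (PU := fun _ h => isOpen_iUnion h)
      (msU := fun _ h => openVariation_iUnion_le T _ h)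
      (m_mono := fun _ _ _ _ h => openVariation_mono T h)] at hr
  simp only [iInf_lt_iff] at hr
  obtain ⟨G, hG, hAG, h⟩ := hr
  exact ⟨G, hAG, hG, by rwa [totalVariation_open T hG]⟩

theorem openVariation_add_le (S T : 𝓓(U, Eucl n) →ₗ[ℝ] ℝ) (G : Set U) :
    openVariation (S + T) G ≤ openVariation S G + openVariation T G := by
  refine iSup_le fun g => ?_
  exact ENNReal.ofReal_add_le.trans
    (add_le_add (le_openVariation S g.1 g.2.1 g.2.2) (le_openVariation T g.1 g.2.1 g.2.2))

theorem totalVariation_add_le (S T : 𝓓(U, Eucl n) →ₗ[ℝ] ℝ) :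
    totalVariation (S + T) ≤ totalVariation S + totalVariation T := by
  refine Measure.le_of_forall_isOpen_le fun G hG => ?_
  rw [Measure.add_apply, totalVariation_open _ hG, totalVariation_open _ hG,
    totalVariation_open _ hG]
  exact openVariation_add_le S T G

@[simp]
theorem totalVariation_zero : totalVariation (0 : 𝓓(U, Eucl n) →ₗ[ℝ] ℝ) = 0 := by
  rw [← Measure.measure_univ_eq_zero, totalVariation_open _ isOpen_univ]
  simp [openVariation]

/-- Lower semicontinuity of a sum of two total variations under pointwise convergence. -/
theorem totalVariation_add_le_of_tendsto {S T : ℕ → 𝓓(U, Eucl n) →ₗ[ℝ] ℝ}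
    {S' T' : 𝓓(U, Eucl n) →ₗ[ℝ] ℝ} {μ : Measure U} [μ.OuterRegular]
    (hS : ∀ g, Tendsto (fun q => S q g) atTop (𝓝 (S' g)))
    (hT : ∀ g, Tendsto (fun q => T q g) atTop (𝓝 (T' g)))
    (h : ∀ q, totalVariation (S q) + totalVariation (T q) ≤ μ) :
    totalVariation S' + totalVariation T' ≤ μ := by
  refine Measure.le_of_forall_isOpen_le fun G hG => ?_
  have (G : Set U) :
      Nonempty {g : 𝓓(U, Eucl n) // tsupport g ⊆ Subtype.val '' G ∧ ∀ x, ‖g x‖ ≤ 1} := by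
    refine ⟨0, ?_, fun x => ?_⟩
    · have : tsupport ((0 : 𝓓(U, Eucl n)) : Eucl n → Eucl n) = ∅ := tsupport_eq_empty_iff.2 rfl
      rw [this]
      exact empty_subset _
    · have : (0 : 𝓓(U, Eucl n)) x = 0 := rfl
      rw [this, norm_zero]
      exact zero_le_one
  rw [Measure.add_apply, totalVariation_open _ hG, totalVariation_open _ hG, openVariation,
    openVariation, ENNReal.iSup_add]
  refine iSup_le fun g₁ => ?_
  rw [ENNReal.add_iSup]
  refine iSup_le fun g₂ => ?_
  -- With one test function fixed in each supremum, independently of `q`, the claim is a limit of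
  -- inequalities.
  refine le_of_tendsto ((ENNReal.tendsto_ofReal (hS g₁.1)).add
    (ENNReal.tendsto_ofReal (hT g₂.1))) (Eventually.of_forall fun q => ?_)
  refine le_trans ?_ (h q G)
  rw [Measure.add_apply, totalVariation_open _ hG, totalVariation_open _ hG]
  exact add_le_add (le_openVariation _ g₁.1 g₁.2.1 g₁.2.2) (le_openVariation _ g₂.1 g₂.2.1 g₂.2.2)

end TotalVariation

/-! ### Bounded sets of compactly supported functions -/

section Bounded

variable {X : Type*} [TopologicalSpace X]

/-- The topology induced by `L` is a locally convex vector topology, so it competes in the infimum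
defining the topology of `𝒦(X)`; only continuity on functions supported in a fixed compact set
remains to be checked. -/
theorem continuous_compactSupport_of_bound {F : Type*} [NormedAddCommGroup F] [NormedSpace ℝ F]
    (L : C_c(X, ℝ) →ₗ[ℝ] F)
    (h : ∀ K : Set X, IsCompact K → ∃ C : ℝ, ∀ f : C_c(X, ℝ), tsupport f ⊆ K →
      ‖L f‖ ≤ C * ‖f.toBoundedContinuousFunction‖) : Continuous L := by
  refine continuous_sInf_dom (t := TopologicalSpace.induced L inferInstance) ?_
    continuous_induced_dom
  refine ⟨fun K hK => ?_, topologicalAddGroup_induced _, continuousSMul_induced _,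
    LocallyConvexSpace.induced _⟩
  obtain ⟨C, hC⟩ := h K hK
  let : TopologicalSpace {f : C_c(X, ℝ) // tsupport f ⊆ K} :=
    TopologicalSpace.induced (fun f => f.1.toBoundedContinuousFunction) inferInstance
  rw [continuous_induced_rng, continuous_iff_continuousAt]
  intro f₀
  have h0 : Tendsto (fun f : {f : C_c(X, ℝ) // tsupport f ⊆ K} =>
      f.1.toBoundedContinuousFunction) (𝓝 f₀) (𝓝 f₀.1.toBoundedContinuousFunction) :=
    continuous_induced_dom.tendsto _
  refine tendsto_iff_norm_sub_tendsto_zero.2 ?_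
  have h1 := (tendsto_iff_norm_sub_tendsto_zero.1 h0).const_mul C
  rw [mul_zero] at h1
  refine squeeze_zero (fun _ => norm_nonneg _) (fun f => ?_) h1
  have h2 : tsupport (f.1 - f₀.1 : C_c(X, ℝ)) ⊆ K :=
    (tsupport_sub _ _).trans (union_subset f.2 f₀.2)
  have h3 := hC _ h2
  rw [map_sub] at h3
  refine h3.trans (le_of_eq ?_)
  congr 2

theorem exists_norm_le_of_isVonNBounded {F : Type*} [NormedAddCommGroup F] [NormedSpace ℝ F]
    {L : C_c(X, ℝ) →ₗ[ℝ] F} (hL : Continuous L) {B : Set C_c(X, ℝ)}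
    (hB : Bornology.IsVonNBounded ℝ B) : ∃ C : ℝ, ∀ f ∈ B, ‖L f‖ ≤ C := by
  have h1 : L ⁻¹' Metric.ball 0 1 ∈ 𝓝 (0 : C_c(X, ℝ)) := by
    refine hL.continuousAt.preimage_mem_nhds ?_
    rw [map_zero]
    exact Metric.ball_mem_nhds _ one_pos
  obtain ⟨r, hr, h2⟩ := (hB h1).exists_pos
  refine ⟨r, fun f hf => ?_⟩
  obtain ⟨g, hg, rfl⟩ := h2 r (le_abs_self r) hf
  have hg' : ‖L g‖ < 1 := by simpa using hg
  simp only [map_smul, norm_smul, Real.norm_of_nonneg hr.le]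
  nlinarith

/-- The map `f ↦ (w i * f (y i))` into `ℓ^∞` is continuous, since for `f` supported in `K` only the
indices with `y i ∈ K` matter. A suitable choice of points and weights detects a failure of uniform
bounds or of common support. -/
theorem exists_weighted_bound_of_isVonNBounded {ι : Type*} (y : ι → X) (w : ι → ℝ)
    (hw : ∀ K : Set X, IsCompact K → ∃ C : ℝ, ∀ i, y i ∈ K → |w i| ≤ C)
    {B : Set C_c(X, ℝ)} (hB : Bornology.IsVonNBounded ℝ B) :
    ∃ C : ℝ, ∀ f ∈ B, ∀ i, |w i * f (y i)| ≤ C := by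
  have key : ∀ K : Set X, IsCompact K → ∃ C : ℝ, 0 ≤ C ∧ ∀ f : C_c(X, ℝ), tsupport f ⊆ K →
      ∀ i, ‖w i * f (y i)‖ ≤ C * ‖f.toBoundedContinuousFunction‖ := by
    intro K hK
    obtain ⟨C, hC⟩ := hw K hK
    refine ⟨max C 0, le_max_right _ _, fun f hf i => ?_⟩
    have hn : |f (y i)| ≤ ‖f.toBoundedContinuousFunction‖ :=
      f.toBoundedContinuousFunction.norm_coe_le_norm (y i)
    by_cases hi : y i ∈ K
    · rw [Real.norm_eq_abs, abs_mul]
      exact mul_le_mul ((hC i hi).trans (le_max_left _ _)) hn (abs_nonneg _) (le_max_right _ _)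
    · have h0 : f (y i) = 0 := image_eq_zero_of_notMem_tsupport fun h => hi (hf h)
      rw [h0, mul_zero, norm_zero]
      exact mul_nonneg (le_max_right _ _) (norm_nonneg _)
  let L : C_c(X, ℝ) →ₗ[ℝ] lp (fun _ : ι => ℝ) ∞ :=
    { toFun := fun f => ⟨fun i => w i * f (y i), by
        obtain ⟨C, -, hC⟩ := key _ f.hasCompactSupport
        refine memℓp_infty ⟨C * ‖f.toBoundedContinuousFunction‖, ?_⟩
        rintro _ ⟨i, rfl⟩
        exact hC f Subset.rfl i⟩
      map_add' := fun f g => by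
        ext i
        exact mul_add _ _ _
      map_smul' := fun c f => by
        ext i
        exact mul_left_comm _ _ _ }
  have hL : Continuous L := by
    refine continuous_compactSupport_of_bound L fun K hK => ?_
    obtain ⟨C, hC0, hC⟩ := key K hK
    exact ⟨C, fun f hf => lp.norm_le_of_forall_le (mul_nonneg hC0 (norm_nonneg _)) (hC f hf)⟩
  obtain ⟨C, hC⟩ := exists_norm_le_of_isVonNBounded hL hB
  exact ⟨C, fun f hf i => (lp.norm_apply_le_norm ENNReal.top_ne_zero (L f) i).trans (hC f hf)⟩

/-- A bounded set of compactly supported continuous functions is uniformly bounded and supported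
in a common compact set. -/
theorem exists_common_support_of_isVonNBounded [WeaklyLocallyCompactSpace X]
    [SigmaCompactSpace X] {B : Set C_c(X, ℝ)} (hB : Bornology.IsVonNBounded ℝ B) :
    ∃ (K : Set X) (C : ℝ), IsCompact K ∧ 0 ≤ C ∧
      ∀ f ∈ B, (∀ x, |f x| ≤ C) ∧ ∀ x, x ∉ K → f x = 0 := by
  obtain ⟨C, hC⟩ := exists_weighted_bound_of_isVonNBounded (fun x : X => x) (fun _ => 1)
    (fun _ _ => ⟨1, fun _ _ => by simp⟩) hB
  simp only [one_mul] at hC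
  suffices h : ∃ j, ∀ f ∈ B, ∀ x, x ∉ CompactExhaustion.choice X j → f x = 0 by
    obtain ⟨j, hj⟩ := h
    exact ⟨_, max C 0, (CompactExhaustion.choice X).isCompact j, le_max_right _ _,
      fun f hf => ⟨fun x => (hC f hf x).trans (le_max_left _ _), hj f hf⟩⟩
  by_contra! hcon
  choose f hfB x hxK hfx using hcon
  -- The points `x j` leave every compact set, so only finitely many weights matter on each; but
  -- these weights send `f j` to `j` in the `j`-th coordinate, which is unbounded.
  obtain ⟨D, hD⟩ := exists_weighted_bound_of_isVonNBounded x (fun j : ℕ => j / f j (x j))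
    (fun K hK => by
    obtain ⟨N, hN⟩ := (CompactExhaustion.choice X).exists_superset_of_isCompact hK
    obtain ⟨M, hM⟩ := ((finite_lt_nat N).image fun j : ℕ => |(j : ℝ) / f j (x j)|).bddAbove
    refine ⟨M, fun j hj => hM (mem_image_of_mem _ ?_)⟩
    by_contra hlt
    exact hxK j ((CompactExhaustion.choice X).subset (not_lt.1 hlt) (hN hj))) hB
  obtain ⟨j, hj⟩ := exists_nat_gt D
  have := hD _ (hfB j) j
  rw [div_mul_cancel₀ _ (hfx j), abs_of_nonneg (Nat.cast_nonneg j)] at this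
  linarith

end Bounded

/-! ### Local convergence in mass -/

namespace Varifold

variable {m n : ℕ} {U : Opens (Eucl n)}

instance : LocallyCompactSpace U := U.isOpen.locallyCompactSpace

instance : SigmaCompactSpace U := inferInstance

theorem ext_toMeasure {V W : Varifold m U} (h : V.toMeasure = W.toMeasure) : V = W := by
  cases V
  cases W
  cases h
  rfl

@[simp]
theorem toMeasure_zero : (0 : Varifold m U).toMeasure = 0 := rfl

@[simp]
theorem toMeasure_add (V W : Varifold m U) :
    (V + W).toMeasure = V.toMeasure + W.toMeasure := rfl

instance : AddCommMonoid (Varifold m U) where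
  add_assoc _ _ _ := ext_toMeasure (add_assoc _ _ _)
  zero_add _ := ext_toMeasure (zero_add _)
  add_zero _ := ext_toMeasure (add_zero _)
  add_comm _ _ := ext_toMeasure (add_comm _ _)
  nsmul := nsmulRec

instance sigmaFinite_toMeasure (V : Varifold m U) : SigmaFinite V.toMeasure := inferInstance

theorem firstVariation_add (V W : Varifold m U) :
    (V + W).firstVariation = V.firstVariation + W.firstVariation := by
  ext g
  exact integral_add_measure (V.integrable_tangentialDivergence g)
    (W.integrable_tangentialDivergence g)

@[simp]
theorem firstVariation_zero : (0 : Varifold m U).firstVariation = 0 := by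
  ext g
  exact integral_zero_measure _

@[simp]
theorem variation_zero : (0 : Varifold m U).variation = 0 := by
  simp [variation]

theorem variation_add_le (V W : Varifold m U) :
    (V + W).variation ≤ V.variation + W.variation := by
  rw [variation, firstVariation_add]
  exact totalVariation_add_le _ _

instance (V : Varifold m U) : V.variation.OuterRegular :=
  inferInstanceAs (totalVariation _).OuterRegular

/-- The varifolds `X q` and `Y` differ by a positive varifold whose mass on each compact set tends
to `0`. -/
def TendstoInMass (X : ℕ → Varifold m U) (Y : Varifold m U) : Prop :=
  ∃ T : ℕ → Varifold m U, (∀ q, X q = Y + T q ∨ Y = X q + T q) ∧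
    ∀ K : Set (U × Gr n m), IsCompact K → Tendsto (fun q => (T q).toMeasure K) atTop (𝓝 0)

theorem abs_integral_le (T : Varifold m U) {f : U × Gr n m → ℝ} {K : Set (U × Gr n m)} {C : ℝ}
    (hK : IsCompact K) (hC : ∀ p, |f p| ≤ C) (hf : ∀ p, p ∉ K → f p = 0) :
    |∫ p, f p ∂T.toMeasure| ≤ C * (T.toMeasure K).toReal := by
  rw [← setIntegral_eq_integral_of_forall_compl_eq_zero hf]
  exact norm_setIntegral_le_of_norm_le_const (f := f) hK.measure_lt_top fun p _ => hC p

theorem abs_integral_sub_le {X Y T : Varifold m U} (h : X = Y + T ∨ Y = X + T)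
    {f : U × Gr n m → ℝ} {K : Set (U × Gr n m)} {C : ℝ} (hfc : Continuous f)
    (hK : IsCompact K) (hC : ∀ p, |f p| ≤ C) (hf : ∀ p, p ∉ K → f p = 0) :
    |∫ p, f p ∂X.toMeasure - ∫ p, f p ∂Y.toMeasure| ≤ C * (T.toMeasure K).toReal := by
  have hi : ∀ W : Varifold m U, Integrable f W.toMeasure := fun W =>
    hfc.integrable_of_hasCompactSupport (HasCompactSupport.intro hK hf)
  rcases h with rfl | rfl
  · rw [toMeasure_add, integral_add_measure (hi _) (hi _), add_sub_cancel_left]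
    exact T.abs_integral_le hK hC hf
  · rw [toMeasure_add, integral_add_measure (hi _) (hi _), sub_add_cancel_left, abs_neg]
    exact T.abs_integral_le hK hC hf

theorem TendstoInMass.tendsto_firstVariation {X : ℕ → Varifold m U} {Y : Varifold m U}
    (h : TendstoInMass X Y) (g : 𝓓(U, Eucl n)) :
    Tendsto (fun q => (X q).firstVariation g) atTop (𝓝 (Y.firstVariation g)) := by
  obtain ⟨T, hT, hK⟩ := h
  have hc := continuous_tangentialDivergence (m := m) g
  have hs := hasCompactSupport_tangentialDivergence (m := m) g
  obtain ⟨C, hC⟩ := hs.exists_bound_of_continuous hc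
  refine tendsto_iff_dist_tendsto_zero.2 ?_
  have h0 := ((ENNReal.tendsto_toReal ENNReal.zero_ne_top).comp (hK _ hs)).const_mul C
  rw [ENNReal.toReal_zero, mul_zero] at h0
  exact squeeze_zero (fun _ => dist_nonneg) (fun q => abs_integral_sub_le (hT q) hc hs hC
    fun p hp => image_eq_zero_of_notMem_tsupport hp) h0

/-- A bounded set of test functions has a common compact support `K` and a common bound `C`, so the
integrals differ by at most `C * T q K`, uniformly on the set. -/
theorem TendstoInMass.tendsto_strongTopology {X : ℕ → Varifold m U} {Y : Varifold m U}
    (h : TendstoInMass X Y) :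
    Tendsto X atTop (@nhds _ (strongTopology m U) Y) := by
  obtain ⟨T, hT, hK⟩ := h
  rw [nhds_induced, tendsto_comap_iff]
  refine (UniformConvergenceCLM.tendsto_iff_tendstoUniformlyOn _ _ _).2 fun B hB => ?_
  obtain ⟨K, C, hKc, hC0, hBK⟩ := exists_common_support_of_isVonNBounded hB
  rw [Metric.tendstoUniformlyOn_iff]
  intro ε hε
  have h0 := ((ENNReal.tendsto_toReal ENNReal.zero_ne_top).comp (hK _ hKc)).const_mul C
  rw [ENNReal.toReal_zero, mul_zero] at h0
  filter_upwards [h0.eventually_lt_const hε] with q hq f hf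
  rw [dist_comm]
  exact (abs_integral_sub_le (hT q) f.continuous hKc (hBK f hf).1 (hBK f hf).2).trans_lt hq

theorem IsAppropriate.mem_of_tendstoInMass {P : Set (Varifold m U)} (hP : IsAppropriate P)
    {X : ℕ → Varifold m U} {Y : Varifold m U} (h : TendstoInMass X Y)
    (hX : ∃ᶠ q in atTop, X q ∈ P) : Y ∈ P :=
  @IsClosed.mem_of_frequently_of_tendsto _ (strongTopology m U) _ _ _ _ _ hP.isClosed hX
    h.tendsto_strongTopology

end Varifold

/-! ### Splittings of varifolds and their limits -/

section Measure

variable {X : Type*} [MeasurableSpace X]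

/-- The difference is `μ` with density `1 - dν/dμ`, where `dν/dμ ≤ 1` almost everywhere. -/
theorem MeasureTheory.Measure.exists_add_of_le_of_sigmaFinite {μ ν : Measure X} [SigmaFinite μ]
    [SigmaFinite ν] (h : ν ≤ μ) : ∃ τ : Measure X, μ = τ + ν := by
  have hac : ν ≪ μ := Measure.absolutelyContinuous_of_le h
  refine ⟨μ.withDensity fun x => 1 - ν.rnDeriv μ x, ?_⟩
  have h1 := withDensity_add_right (μ := μ) (fun x => 1 - ν.rnDeriv μ x)
    (ν.measurable_rnDeriv μ)
  rw [Measure.withDensity_rnDeriv_eq ν μ hac] at h1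
  rw [← h1]
  conv_lhs => rw [← withDensity_one (μ := μ)]
  refine withDensity_congr_ae ?_
  filter_upwards [Measure.rnDeriv_le_one_of_le h] with x hx
  exact (tsub_add_cancel_of_le hx).symm

theorem MeasureTheory.Measure.add_right_cancel_of_sigmaFinite {μ ν τ : Measure X} [SigmaFinite τ]
    (h : μ + τ = ν + τ) : μ = ν := by
  refine (Measure.ext_iff_of_iUnion_eq_univ (iUnion_spanningSets τ)).2 fun i => ?_
  ext A hA
  rw [Measure.restrict_apply hA, Measure.restrict_apply hA]
  have hfin : τ (A ∩ spanningSets τ i) ≠ ⊤ :=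
    (measure_mono inter_subset_right).trans_lt (measure_spanningSets_lt_top τ i) |>.ne
  have := congrArg (fun ρ : Measure X => ρ (A ∩ spanningSets τ i)) h
  simpa [ENNReal.add_left_inj hfin] using this

end Measure

namespace Varifold

variable {m n : ℕ} {U : Opens (Eucl n)}

theorem add_right_cancel {V W X : Varifold m U} (h : V + X = W + X) : V = W :=
  ext_toMeasure (Measure.add_right_cancel_of_sigmaFinite (congrArg toMeasure h))

/-- `V = W + X` and `‖δV‖ = ‖δW‖ + ‖δX‖`. -/
structure Splits (V W X : Varifold m U) : Prop where
  eq_add : V = W + X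
  variation_eq : V.variation = W.variation + X.variation

theorem Splits.symm {V W X : Varifold m U} (h : Splits V W X) : Splits V X W :=
  ⟨h.eq_add.trans (add_comm _ _), h.variation_eq.trans (add_comm _ _)⟩

theorem splits_zero_right (V : Varifold m U) : Splits V V 0 := ⟨by simp, by simp⟩

theorem Splits.le_left {V W X : Varifold m U} (h : Splits V W X) : W.toMeasure ≤ V.toMeasure := by
  rw [h.eq_add]
  exact Measure.le_add_right le_rfl

theorem Splits.le_right {V W X : Varifold m U} (h : Splits V W X) : X.toMeasure ≤ V.toMeasure :=
  h.symm.le_left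

theorem Splits.variation_le_left {V W X : Varifold m U} (h : Splits V W X) :
    W.variation ≤ V.variation := by
  rw [h.variation_eq]
  exact Measure.le_add_right le_rfl

theorem Splits.variation_le_right {V W X : Varifold m U} (h : Splits V W X) :
    X.variation ≤ V.variation := h.symm.variation_le_left

/-- Subadditivity of `‖δ·‖` gives one inequality for the regrouped sum; it also gives `‖δ(Y + X)‖ ≤
‖δY‖ + ‖δX‖`, which yields the reverse inequality. -/
theorem Splits.trans {V W X W' Y : Varifold m U} (h : Splits V W X) (h' : Splits W W' Y) :
    Splits V W' (Y + X) := by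
  have h1 : V = W' + (Y + X) := by rw [h.eq_add, h'.eq_add, add_assoc]
  refine ⟨h1, le_antisymm ?_ ?_⟩
  · conv_lhs => rw [h1]
    exact variation_add_le _ _
  · rw [h.variation_eq, h'.variation_eq, add_assoc]
    exact add_le_add_right (variation_add_le _ _) _

/-- A splitting is preserved under limits in mass. -/
theorem Splits.of_tendstoInMass {V W X : Varifold m U} {Wq Xq : ℕ → Varifold m U}
    (h : ∀ q, Splits V (Wq q) (Xq q)) (hW : TendstoInMass Wq W) (hX : TendstoInMass Xq X)
    (hV : V = W + X) : Splits V W X := by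
  refine ⟨hV, le_antisymm ?_ ?_⟩
  · conv_lhs => rw [hV]
    exact variation_add_le _ _
  -- Additivity survives by lower semicontinuity: the sum of the two variations equals `‖δV‖` for
  -- each `q`, so in the limit it does not exceed it.
  · exact totalVariation_add_le_of_tendsto hW.tendsto_firstVariation hX.tendsto_firstVariation
      fun q => (h q).variation_eq.ge

theorem toMeasure_sum {ι : Type*} (s : Finset ι) (D : ι → Varifold m U) :
    (∑ i ∈ s, D i).toMeasure = ∑ i ∈ s, (D i).toMeasure :=
  map_sum ({ toFun := toMeasure, map_zero' := rfl, map_add' := fun _ _ => rfl } :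
    Varifold m U →+ Measure (U × Gr n m)) D s

theorem splits_sum_range {W D : ℕ → Varifold m U} (h : ∀ j, Splits (W j) (W (j + 1)) (D j))
    (j q : ℕ) : Splits (W j) (W (j + q)) (∑ i ∈ Finset.range q, D (j + i)) := by
  induction q with
  | zero => simpa using splits_zero_right (W j)
  | succ q ih =>
    rw [Finset.sum_range_succ, add_comm (Finset.sum _ _)]
    exact ih.trans (h (j + q))

/-- The limit of a sequence of successive splittings. -/
theorem exists_splits_limit {W D : ℕ → Varifold m U}
    (h : ∀ j, Splits (W j) (W (j + 1)) (D j)) :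
    ∃ (W' : Varifold m U) (Y : ℕ → Varifold m U), (∀ j, Splits (W j) W' (Y j)) ∧
      (∀ j, TendstoInMass (fun q => W (j + q)) W') ∧
      (∀ j, TendstoInMass (fun q => ∑ i ∈ Finset.range q, D (j + i)) (Y j)) ∧
      ∀ j, (Y j).toMeasure = Measure.sum fun i => (D (j + i)).toMeasure := by
  -- Every partial sum of the discarded pieces is a part of `W j`, so the full sum is again a Radon
  -- measure.
  have hle : ∀ j, Measure.sum (fun i => (D (j + i)).toMeasure) ≤ (W j).toMeasure := by
    intro j
    refine Measure.le_iff.2 fun A hA => ?_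
    rw [Measure.sum_apply _ hA, ENNReal.tsum_eq_iSup_nat]
    refine iSup_le fun q => ?_
    have := (splits_sum_range h j q).le_right A
    rwa [toMeasure_sum, Measure.finsetSum_apply] at this
  let Y : ℕ → Varifold m U := fun j => ⟨Measure.sum fun i => (D (j + i)).toMeasure,
    ⟨fun _ hK => (hle j _).trans_lt hK.measure_lt_top⟩⟩
  have hYadd : ∀ j q, Y j = (∑ i ∈ Finset.range q, D (j + i)) + Y (j + q) := by
    intro j q
    refine ext_toMeasure (Measure.ext fun A hA => ?_)
    rw [toMeasure_add, toMeasure_sum, Measure.add_apply, Measure.finsetSum_apply]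
    change Measure.sum _ A = _ + Measure.sum _ A
    rw [Measure.sum_apply _ hA, Measure.sum_apply _ hA]
    refine (Summable.sum_add_tsum_nat_add' (f := fun i => (D (j + i)).toMeasure A) (k := q)
      ENNReal.summable).symm.trans ?_
    congr 1
    exact tsum_congr fun i => by rw [add_comm i q, add_assoc]
  have : SigmaFinite (Y 0).toMeasure := sigmaFinite_toMeasure (Y 0)
  obtain ⟨τ, hτ⟩ := Measure.exists_add_of_le_of_sigmaFinite (ν := (Y 0).toMeasure)
    (by simpa [Y] using hle 0)
  let W' : Varifold m U := ⟨τ, ⟨fun K hK => by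
    refine lt_of_le_of_lt ?_ (hK.measure_lt_top (μ := (W 0).toMeasure))
    rw [hτ]
    exact Measure.le_add_right le_rfl K⟩⟩
  have h0 : W 0 = W' + Y 0 := ext_toMeasure hτ
  -- The limit is constructed as `W 0 - Y 0`; cancelling the first `j` pieces identifies it with `W
  -- j - Y j`.
  have hW : ∀ j, W j = W' + Y j := by
    intro j
    have h1 := (splits_sum_range h 0 j).eq_add
    have h2 := hYadd 0 j
    simp only [zero_add] at h1 h2
    refine add_right_cancel (X := ∑ i ∈ Finset.range j, D i) ?_
    rw [← h1, h0, h2, add_assoc, add_comm (Y j)]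
  -- The error terms are tails of the convergent series of the numbers `D i K`.
  have htail : ∀ j, ∀ K : Set (U × Gr n m), IsCompact K →
      Tendsto (fun q => (Y (j + q)).toMeasure K) atTop (𝓝 0) := by
    intro j K hK
    have hKm := hK.measurableSet
    have hfin : ∑' i, (D (j + i)).toMeasure K ≠ ⊤ := by
      rw [← Measure.sum_apply _ hKm]
      exact ((hle j K).trans_lt hK.measure_lt_top).ne
    refine (ENNReal.tendsto_sum_nat_add _ hfin).congr fun q => ?_
    change _ = Measure.sum _ K
    rw [Measure.sum_apply _ hKm]
    exact tsum_congr fun i => by rw [add_comm i q, add_assoc]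
  have hlim : ∀ j, TendstoInMass (fun q => W (j + q)) W' := fun j =>
    ⟨fun q => Y (j + q), fun q => Or.inl (hW _), htail j⟩
  have hlim' : ∀ j, TendstoInMass (fun q => ∑ i ∈ Finset.range q, D (j + i)) (Y j) := fun j =>
    ⟨fun q => Y (j + q), fun q => Or.inr (hYadd j q), htail j⟩
  exact ⟨W', Y, fun j => Splits.of_tendstoInMass (fun q => splits_sum_range h j q) (hlim j)
    (hlim' j) (hW j), hlim, hlim', fun j => rfl⟩

end Varifold

/-! ### Parts of a varifold within an appropriate class -/

namespace Varifold

variable {m n : ℕ} {U : Opens (Eucl n)} {P : Set (Varifold m U)}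

/-- `W` and `V - W` belong to `P`, except that `V - W` may vanish, and `‖δ·‖` is additive. -/
def IsPart (P : Set (Varifold m U)) (V W : Varifold m U) : Prop :=
  W ∈ P ∧ ∃ X, (X ∈ P ∨ X = 0) ∧ Splits V W X

/-- An appropriate class need not contain `0`, so remainders live in `P ∪ {0}`, which is stable
under sums and under limits in mass. -/
theorem IsAppropriate.add_mem_or_eq_zero (hP : IsAppropriate P) {V W : Varifold m U}
    (hV : V ∈ P ∨ V = 0) (hW : W ∈ P ∨ W = 0) : V + W ∈ P ∨ V + W = 0 := by
  rcases hV with hV | rfl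
  · rcases hW with hW | rfl
    · exact Or.inl (hP.add_mem V hV W hW)
    · rw [add_zero]
      exact Or.inl hV
  · rwa [zero_add]

theorem IsAppropriate.sum_mem_or_eq_zero (hP : IsAppropriate P) {D : ℕ → Varifold m U}
    (hD : ∀ i, D i ∈ P ∨ D i = 0) (q : ℕ) :
    (∑ i ∈ Finset.range q, D i) ∈ P ∨ (∑ i ∈ Finset.range q, D i) = 0 := by
  induction q with
  | zero => simp
  | succ q ih =>
    rw [Finset.sum_range_succ]
    exact hP.add_mem_or_eq_zero ih (hD q)

theorem TendstoInMass.eq_zero {Y : Varifold m U} {X : ℕ → Varifold m U} (h : TendstoInMass X Y)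
    (hX : ∀ᶠ q in atTop, X q = 0) : Y = 0 := by
  obtain ⟨T, hT, hK⟩ := h
  refine ext_toMeasure ?_
  rw [toMeasure_zero, ← Measure.measure_univ_eq_zero, ← iUnion_compactCovering]
  refine measure_iUnion_null fun i => ?_
  have h0 : ∀ᶠ q in atTop, Y.toMeasure (compactCovering (U × Gr n m) i) ≤
      (T q).toMeasure (compactCovering (U × Gr n m) i) := by
    filter_upwards [hX] with q hq
    rcases hT q with h | h
    · have : (0 : Measure (U × Gr n m)) = Y.toMeasure + (T q).toMeasure := by
        rw [← toMeasure_add, ← h, hq, toMeasure_zero]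
      have h1 : Y.toMeasure ≤ 0 := this ▸ Measure.le_add_right le_rfl
      exact (h1 _).trans (zero_le)
    · rw [h, hq, zero_add]
  exact le_antisymm (ge_of_tendsto (hK _ (isCompact_compactCovering _ i)) h0) zero_le

/-- Either infinitely many terms lie in `P` and closedness applies, or the terms are eventually `0`
and so is the limit. -/
theorem IsAppropriate.mem_or_eq_zero_of_tendstoInMass (hP : IsAppropriate P)
    {X : ℕ → Varifold m U} {Y : Varifold m U} (h : TendstoInMass X Y)
    (hX : ∀ q, X q ∈ P ∨ X q = 0) : Y ∈ P ∨ Y = 0 := by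
  by_cases hfr : ∃ᶠ q in atTop, X q ∈ P
  · exact Or.inl (hP.mem_of_tendstoInMass h hfr)
  · rw [not_frequently] at hfr
    exact Or.inr (h.eq_zero (hfr.mono fun q hq => (hX q).resolve_left hq))

theorem isPart_refl {V : Varifold m U} (hV : V ∈ P) : IsPart P V V :=
  ⟨hV, 0, Or.inr rfl, splits_zero_right V⟩

theorem IsPart.trans (hP : IsAppropriate P) {V W W' : Varifold m U} (h : IsPart P V W)
    (h' : IsPart P W W') : IsPart P V W' := by
  obtain ⟨-, X, hX, hs⟩ := h
  obtain ⟨hW', Y, hY, hs'⟩ := h'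
  exact ⟨hW', Y + X, hP.add_mem_or_eq_zero hY hX, hs.trans hs'⟩

theorem IsPart.toMeasure_le {V W : Varifold m U} (h : IsPart P V W) :
    W.toMeasure ≤ V.toMeasure := by
  obtain ⟨-, X, -, hs⟩ := h
  exact hs.le_left

theorem IsPart.variation_le {V W : Varifold m U} (h : IsPart P V W) :
    W.variation ≤ V.variation := by
  obtain ⟨-, X, -, hs⟩ := h
  exact hs.variation_le_left

/-- Among the parts charging `A`, one can be chosen that does not split into two parts charging
`A`, provided that such parts have a minimal amount of mass in a fixed compact set. -/
theorem exists_isPart_unsplittable (hP : IsAppropriate P) {R : Varifold m U} (hR : R ∈ P)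
    {A K : Set (U × Gr n m)} (hK : IsCompact K) {δ : ℝ≥0∞} (hδ0 : δ ≠ 0)
    (hδ : ∀ W ∈ P, W.toMeasure ≤ R.toMeasure → W.variation ≤ R.variation →
      W.toMeasure A ≠ 0 → δ ≤ W.toMeasure K) (hA : R.toMeasure A ≠ 0) :
    ∃ W, IsPart P R W ∧ W.toMeasure A ≠ 0 ∧ ∀ W' X', W' ∈ P → X' ∈ P ∨ X' = 0 →
      Splits W W' X' → W'.toMeasure A ≠ 0 → X'.toMeasure A = 0 := by
  set M : ℝ≥0∞ := ⨅ W : {W // IsPart P R W ∧ W.toMeasure A ≠ 0}, W.1.toMeasure K with hM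
  have hMtop : M ≠ ⊤ :=
    ((iInf_le (fun W : {W // IsPart P R W ∧ W.toMeasure A ≠ 0} => W.1.toMeasure K)
      ⟨R, isPart_refl hR, hA⟩).trans_lt hK.measure_lt_top).ne
  -- `W` has mass less than `M + δ` in `K`. If both summands charged `A`, one would contribute at
  -- least `M` and the other at least `δ`.
  obtain ⟨⟨W, hW, hWA⟩, hlt⟩ := iInf_lt_iff.1 (ENNReal.lt_add_right hMtop hδ0)
  refine ⟨W, hW, hWA, fun W' X' hW' hX' hs hW'A => ?_⟩
  by_contra hX'A
  have hX'P : X' ∈ P := hX'.resolve_right fun h => hX'A (by simp [h])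
  have h1 : M ≤ W'.toMeasure K :=
    iInf_le (fun W : {W // IsPart P R W ∧ W.toMeasure A ≠ 0} => W.1.toMeasure K)
      ⟨W', hW.trans hP ⟨hW', X', hX', hs⟩, hW'A⟩
  have hX'R : IsPart P R X' := hW.trans hP ⟨hX'P, W', Or.inl hW', hs.symm⟩
  have h2 : δ ≤ X'.toMeasure K := hδ X' hX'P hX'R.toMeasure_le hX'R.variation_le hX'A
  have h3 : W.toMeasure K = W'.toMeasure K + X'.toMeasure K := by
    rw [hs.eq_add, toMeasure_add, Measure.add_apply]
  exact absurd hlt (not_lt.2 (h3 ▸ add_le_add h1 h2))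

theorem exists_isPart_almost_minimal {R : Varifold m U} (hR : R ∈ P)
    {A : Set (U × Gr n m)} (hA : R.toMeasure A ≠ 0) (Φ : Varifold m U → ℝ≥0∞) (hΦ : Φ R ≠ ⊤)
    {ε : ℝ≥0∞} (hε : ε ≠ 0) :
    ∃ W, (IsPart P R W ∧ W.toMeasure A ≠ 0) ∧
      ∀ W', IsPart P R W' → W'.toMeasure A ≠ 0 → Φ W ≤ Φ W' + ε := by
  set M : ℝ≥0∞ := ⨅ W : {W // IsPart P R W ∧ W.toMeasure A ≠ 0}, Φ W.1 with hM
  have hle : ∀ W', IsPart P R W' → W'.toMeasure A ≠ 0 → M ≤ Φ W' := fun W' h h' =>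
    iInf_le (fun W : {W // IsPart P R W ∧ W.toMeasure A ≠ 0} => Φ W.1) ⟨W', h, h'⟩
  have hMtop : M ≠ ⊤ := ((hle R (isPart_refl hR) hA).trans_lt (lt_top_iff_ne_top.2 hΦ)).ne
  obtain ⟨W, hlt⟩ := iInf_lt_iff.1 (ENNReal.lt_add_right hMtop hε)
  exact ⟨W.1, W.2, fun W' h h' => hlt.le.trans (add_le_add_left (hle W' h h') _)⟩

/-- An unsplittable part charging `A` contains an indecomposable part charging `A`. -/
theorem exists_isIndecomposable_of_unsplittable (hP : IsAppropriate P) {R : Varifold m U}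
    (hR : R ∈ P) {A : Set (U × Gr n m)} (hA : R.toMeasure A ≠ 0)
    (hun : ∀ W' X', W' ∈ P → X' ∈ P ∨ X' = 0 → Splits R W' X' → W'.toMeasure A ≠ 0 →
      X'.toMeasure A = 0) :
    ∃ W, IsPart P R W ∧ W.toMeasure A ≠ 0 ∧ IsIndecomposable P W := by
  -- Strict positivity of `g` makes `Φ` vanish only at `0`; integrability against `R` makes `Φ`
  -- finite on all parts of `R`.
  obtain ⟨g, hg0, hgm, hgR⟩ := exists_pos_lintegral_lt_of_sigmaFinite R.toMeasure one_ne_zero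
  let Φ : Varifold m U → ℝ≥0∞ := fun W => ∫⁻ p, g p ∂W.toMeasure
  have hΦmono : ∀ {V W : Varifold m U}, W.toMeasure ≤ V.toMeasure → Φ W ≤ Φ V := fun h =>
    lintegral_mono' h le_rfl
  have hΦtop : ∀ {W : Varifold m U}, W.toMeasure ≤ R.toMeasure → Φ W ≠ ⊤ := fun h =>
    ((hΦmono h).trans_lt (hgR.trans ENNReal.one_lt_top)).ne
  have step : ∀ (j : ℕ) (W : {W // IsPart P R W ∧ W.toMeasure A ≠ 0}),
      ∃ W' : {W // IsPart P R W ∧ W.toMeasure A ≠ 0}, IsPart P W.1 W'.1 ∧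
        ∀ W'', IsPart P W.1 W'' → W''.toMeasure A ≠ 0 →
          Φ W'.1 ≤ Φ W'' + ((j : ℝ≥0∞) + 1)⁻¹ := by
    rintro j ⟨W, hW, hWA⟩
    obtain ⟨W', ⟨h1, h2⟩, h3⟩ := exists_isPart_almost_minimal (P := P) hW.1 hWA Φ
      (hΦtop hW.toMeasure_le) (ε := ((j : ℝ≥0∞) + 1)⁻¹)
      (ENNReal.inv_ne_zero.2 (by finiteness))
    exact ⟨⟨W', hW.trans hP h1, h2⟩, h1, h3⟩
  choose F hF1 hF2 using step
  let S : ℕ → {W // IsPart P R W ∧ W.toMeasure A ≠ 0} := fun j =>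
    Nat.rec ⟨R, isPart_refl hR, hA⟩ F j
  have hS : ∀ j, IsPart P (S j).1 (S (j + 1)).1 := fun j => hF1 j (S j)
  choose _ D hD hsplit using hS
  obtain ⟨W, Y, hWY, hlim, hlim', hY⟩ := exists_splits_limit hsplit
  have hWP : W ∈ P := by
    refine hP.mem_of_tendstoInMass (hlim 0) (Frequently.of_forall fun q => ?_)
    rw [zero_add]
    exact (S q).2.1.1
  have hYP : ∀ j, Y j ∈ P ∨ Y j = 0 := fun j =>
    hP.mem_or_eq_zero_of_tendstoInMass (hlim' j)
      fun q => hP.sum_mem_or_eq_zero (fun i => hD (j + i)) q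
  have hpart : ∀ j, IsPart P (S j).1 W := fun j => ⟨hWP, Y j, hYP j, hWY j⟩
  -- `S (i + 1)` charges `A`, and its remainder in `R` contains `D i`; unsplittability forbids that
  -- remainder to charge `A`. Hence the limit keeps all the mass of `R` in `A`.
  have hDA : ∀ i, (D i).toMeasure A = 0 := by
    intro i
    obtain ⟨-, X, hX, hsX⟩ := (S i).2.1
    have h1 := hun _ _ (S (i + 1)).2.1.1 (hP.add_mem_or_eq_zero (hD i) hX)
      (hsX.trans (hsplit i)) (S (i + 1)).2.2
    rw [toMeasure_add, Measure.add_apply, add_eq_zero] at h1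
    exact h1.1
  have hWA : W.toMeasure A ≠ 0 := by
    intro h0
    apply hA
    have h1 : R = W + Y 0 := (hWY 0).eq_add
    rw [h1, toMeasure_add, Measure.add_apply, h0, zero_add, hY 0, Measure.sum_apply_eq_zero]
    exact fun i => hDA _
  refine ⟨W, hpart 0, hWA, ?_⟩
  -- A part `W'` of the limit that charges `A` competes at every stage, so `Φ W ≤ Φ W' + 1 / (j +
  -- 1)` for all `j`, which forces `Φ X' = 0`.
  have hmin : ∀ W' X', W' ∈ P → X' ∈ P → Splits W W' X' → W'.toMeasure A ≠ 0 → X' = 0 := by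
    intro W' X' hW' hX' hs hW'A
    have h1 : Φ W = Φ W' + Φ X' := by
      simp only [Φ]
      rw [hs.eq_add, toMeasure_add, lintegral_add_measure]
    have h2 : ∀ j : ℕ, Φ X' ≤ ((j : ℝ≥0∞) + 1)⁻¹ := by
      intro j
      have h3 := hF2 j (S j) W' ((hpart j).trans hP ⟨hW', X', Or.inl hX', hs⟩) hW'A
      have h4 : Φ W ≤ Φ (S (j + 1)).1 := hΦmono (hpart (j + 1)).toMeasure_le
      have h5 : Φ W' + Φ X' ≤ Φ W' + ((j : ℝ≥0∞) + 1)⁻¹ := h1 ▸ h4.trans h3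
      exact (ENNReal.add_le_add_iff_left
        (hΦtop (hs.le_left.trans (hpart 0).toMeasure_le))).1 h5
    have h3 : Φ X' = 0 := by
      have ht : Tendsto (fun j : ℕ => ((j : ℝ≥0∞) + 1)⁻¹) atTop (𝓝 0) := by
        simpa using (tendsto_add_atTop_iff_nat 1).2 ENNReal.tendsto_inv_nat_nhds_zero
      exact le_antisymm (ge_of_tendsto' ht h2) zero_le
    refine ext_toMeasure ?_
    rw [lintegral_eq_zero_iff (by fun_prop)] at h3
    rw [toMeasure_zero, ← ae_eq_bot, ← eventually_false_iff_eq_bot]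
    filter_upwards [h3] with p hp
    exact (hg0 p).ne' (by simpa using hp)
  rintro ⟨W', hW', X', hX', hW'0, hX'0, hadd, hvar⟩
  have hs : Splits W W' X' := ⟨hadd, hvar⟩
  -- One of the two summands charges `A`, since `W` does; then the other one vanishes.
  by_cases hW'A : W'.toMeasure A = 0
  · refine hW'0 (hmin X' W' hX' hW' hs.symm fun h => hWA ?_)
    rw [hadd, toMeasure_add, Measure.add_apply, hW'A, h, zero_add]
  · exact hX'0 (hmin W' X' hW' hX' hs hW'A)

theorem exists_isIndecomposable_isPart (hP : IsAppropriate P) {R : Varifold m U} (hR : R ∈ P)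
    {A K : Set (U × Gr n m)} (hK : IsCompact K) {δ : ℝ≥0∞} (hδ0 : δ ≠ 0)
    (hδ : ∀ W ∈ P, W.toMeasure ≤ R.toMeasure → W.variation ≤ R.variation →
      W.toMeasure A ≠ 0 → δ ≤ W.toMeasure K) (hA : R.toMeasure A ≠ 0) :
    ∃ W, IsPart P R W ∧ W.toMeasure A ≠ 0 ∧ IsIndecomposable P W := by
  obtain ⟨W, hW, hWA, hun⟩ := exists_isPart_unsplittable hP hR hK hδ0 hδ hA
  obtain ⟨W', hW', hW'A, hind⟩ := exists_isIndecomposable_of_unsplittable hP hW.1 hWA hun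
  exact ⟨W', hW.trans hP hW', hW'A, hind⟩

end Varifold

/-! ### Exhaustion by indecomposable parts -/

/-- The series is regrouped along the fibres of `D`, on which its terms are constant; terms with `D
q = 0` contribute nothing. -/
theorem hasSum_nat_card_fiber_mul {α : Type*} [Zero α] (D : ℕ → α)
    (hfin : ∀ x, x ≠ 0 → {q | D q = x}.Finite) (ξ : {x | x ≠ 0 ∧ x ∈ range D} → ℕ)
    (hξ : ∀ x, ξ x = {q | D q = x.1}.ncard) (a : α → ℝ) (ha : a 0 = 0) {s : ℝ}
    (hs : HasSum (fun q => a (D q)) s) :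
    HasSum (fun x : {x | x ≠ 0 ∧ x ∈ range D} => (ξ x : ℝ) * a x) s := by
  have h1 : HasSum (fun q : {q // D q ≠ 0} => a (D q)) s :=
    (hasSum_subtype_iff_of_support_subset (s := {q | D q ≠ 0}) (f := fun q => a (D q))
      fun q hq h => hq (by simp [h, ha])).2 hs
  let f : {q // D q ≠ 0} → {x | x ≠ 0 ∧ x ∈ range D} := fun q => ⟨D q, q.2, q.1, rfl⟩
  have h2 := (Equiv.sigmaFiberEquiv f).hasSum_iff.2 h1
  refine h2.sigma fun x => ?_
  let e : {q // f q = x} ≃ {q | D q = x.1} :=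
    { toFun := fun q => ⟨q.1.1, congrArg Subtype.val q.2⟩
      invFun := fun q => ⟨⟨q.1, fun h => x.2.1 (q.2.symm.trans h)⟩, Subtype.ext q.2⟩
      left_inv := fun _ => rfl
      right_inv := fun _ => rfl }
  have : Fintype {q | D q = x.1} := (hfin x x.2.1).fintype
  have h3 : HasSum (fun _ : {q | D q = x.1} => a x) ((ξ x : ℝ) * a x) := by
    convert hasSum_fintype (fun _ : {q | D q = x.1} => a x) using 1
    rw [Finset.sum_const, Finset.card_univ, hξ, nsmul_eq_mul, ← Nat.card_coe_set_eq,
      Nat.card_eq_fintype_card]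
  convert e.hasSum_iff.2 h3 using 1
  funext q
  exact congrArg (fun y : {x | x ≠ 0 ∧ x ∈ range D} => a y.1) q.2

namespace Varifold

variable {m n : ℕ} {U : Opens (Eucl n)} {P : Set (Varifold m U)}

theorem variation_sum_range {W D : ℕ → Varifold m U} (h : ∀ j, Splits (W j) (W (j + 1)) (D j))
    (q : ℕ) : (W 0).variation = ∑ i ∈ Finset.range q, (D i).variation + (W q).variation := by
  induction q with
  | zero => simp
  | succ q ih => rw [Finset.sum_range_succ, ih, (h q).variation_eq, add_assoc, add_comm (D q).variation]

/-- Partial sums give `≥`. For `≤` on an open set, `δV(g)` is the limit of the sums of `δD i (g)`,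
each bounded by `‖δD i‖` of the set. Passage to Borel sets uses that the sum is finite on compact
sets, hence outer regular. -/
theorem variation_eq_sum {V : Varifold m U} (hV : V.HasRadonVariation) {D : ℕ → Varifold m U}
    (hle : ∀ q, ∑ i ∈ Finset.range q, (D i).variation ≤ V.variation)
    (hlim : TendstoInMass (fun q => ∑ i ∈ Finset.range q, D i) V) :
    V.variation = Measure.sum fun i => (D i).variation := by
  have hsum : Measure.sum (fun i => (D i).variation) ≤ V.variation := by
    refine Measure.le_iff.2 fun A hA => ?_
    rw [Measure.sum_apply _ hA, ENNReal.tsum_eq_iSup_nat]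
    refine iSup_le fun q => ?_
    have := hle q A
    rwa [Measure.finsetSum_apply] at this
  refine le_antisymm ?_ hsum
  have : IsFiniteMeasureOnCompacts V.variation := hV
  have : IsFiniteMeasureOnCompacts (Measure.sum fun i => (D i).variation) :=
    ⟨fun K hK => (hsum K).trans_lt hK.measure_lt_top⟩
  refine Measure.le_of_forall_isOpen_le fun G hG => ?_
  rw [variation, totalVariation_open _ hG]
  refine iSup_le fun g => ?_
  refine le_of_tendsto (ENNReal.tendsto_ofReal (hlim.tendsto_firstVariation g.1))
    (Eventually.of_forall fun q => ?_)
  have hfv : (∑ i ∈ Finset.range q, D i).firstVariation g.1 =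
      ∑ i ∈ Finset.range q, (D i).firstVariation g.1 :=
    map_sum ({ toFun := fun W => W.firstVariation g.1
               map_zero' := by simp
               map_add' := fun V W => by rw [firstVariation_add]; rfl } : Varifold m U →+ ℝ) D _
  rw [hfv, Measure.sum_apply _ hG.measurableSet]
  refine (ofReal_sum_le_sum_ofReal _ _).trans (le_trans ?_ (ENNReal.sum_le_tsum (Finset.range q)))
  refine Finset.sum_le_sum fun i _ => ?_
  rw [variation, totalVariation_open _ hG]
  exact le_openVariation _ g.1 g.2.1 g.2.2

theorem exists_sequence_of_isIndecomposable (hP : IsAppropriate P) {V : Varifold m U}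
    (hV : V ∈ P) (hδV : V.HasRadonVariation) (A K : ℕ → Set (U × Gr n m)) (δ : ℕ → ℝ≥0∞)
    (hK : ∀ k, IsCompact (K k)) (hδ0 : ∀ k, δ k ≠ 0) (hA : V.toMeasure (⋃ k, A k)ᶜ = 0)
    (hδ : ∀ k, ∀ W ∈ P, W.toMeasure ≤ V.toMeasure → W.variation ≤ V.variation →
      W.toMeasure (A k) ≠ 0 → δ k ≤ W.toMeasure (K k)) :
    ∃ D : ℕ → Varifold m U, (∀ q, D q = 0 ∨ IsComponent P V (D q)) ∧
      V.toMeasure = Measure.sum (fun i => (D i).toMeasure) ∧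
      V.variation = Measure.sum (fun i => (D i).variation) := by
  -- Stage `q` treats the index `(Nat.unpair q).1`, so each index recurs infinitely often. The
  -- residual stays below `V` in mass and in variation, so the bounds `δ k` fixed for `V` keep
  -- applying.
  have step : ∀ (q : ℕ) (R : {R : Varifold m U // (R ∈ P ∨ R = 0) ∧ R.toMeasure ≤ V.toMeasure ∧
      R.variation ≤ V.variation}), ∃ (R' : {R : Varifold m U // (R ∈ P ∨ R = 0) ∧
        R.toMeasure ≤ V.toMeasure ∧ R.variation ≤ V.variation}) (W : Varifold m U),
      Splits R.1 R'.1 W ∧ (W = 0 ∨ W ∈ P ∧ W ≠ 0 ∧ IsIndecomposable P W) ∧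
        (R.1.toMeasure (A (Nat.unpair q).1) ≠ 0 → W.toMeasure (A (Nat.unpair q).1) ≠ 0) := by
    rintro q ⟨R, hR, hRV, hRV'⟩
    by_cases hRA : R.toMeasure (A (Nat.unpair q).1) = 0
    · exact ⟨⟨R, hR, hRV, hRV'⟩, 0, splits_zero_right R, Or.inl rfl, fun h => absurd hRA h⟩
    · have hRP : R ∈ P := hR.resolve_right fun h => hRA (by simp [h])
      obtain ⟨W, ⟨hWP, X, hX, hs⟩, hWA, hW⟩ := exists_isIndecomposable_isPart hP hRP (hK _) (hδ0 _)
        (fun W hW h h' => hδ _ W hW (h.trans hRV) (h'.trans hRV')) hRA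
      exact ⟨⟨X, hX, hs.le_right.trans hRV, hs.variation_le_right.trans hRV'⟩, W, hs.symm,
        Or.inr ⟨hWP, fun h => hWA (by simp [h]), hW⟩, fun _ => hWA⟩
  choose F G hF hG hGA using step
  let S : ℕ → {R : Varifold m U // (R ∈ P ∨ R = 0) ∧ R.toMeasure ≤ V.toMeasure ∧
      R.variation ≤ V.variation} := fun q => Nat.rec ⟨V, Or.inl hV, le_rfl, le_rfl⟩ F q
  let D : ℕ → Varifold m U := fun q => G q (S q)
  have hsplit : ∀ q, Splits (S q).1 (S (q + 1)).1 (D q) := fun q => hF q (S q)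
  obtain ⟨R, Y, hRY, -, hlim, hY⟩ := exists_splits_limit hsplit
  -- If `R` charged `A k`, so would every residual, and each stage `Nat.pair k i` would remove mass
  -- at least `δ k` from `K k`, whose total mass is finite.
  have hRA : ∀ k, R.toMeasure (A k) = 0 := by
    intro k
    by_contra hk
    have h1 : ∀ i, δ k ≤ (D (Nat.pair k i)).toMeasure (K k) := by
      intro i
      have hS : (S (Nat.pair k i)).1.toMeasure (A k) ≠ 0 := fun h =>
        hk (le_antisymm (((hRY _).le_left _).trans h.le) zero_le)
      have h2 : (D (Nat.pair k i)).toMeasure (A k) ≠ 0 := by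
        have := hGA (Nat.pair k i) (S (Nat.pair k i))
        rw [Nat.unpair_pair] at this
        exact this hS
      rcases hG (Nat.pair k i) (S (Nat.pair k i)) with h0 | ⟨hDP, -, -⟩
      · exact absurd (by simp [D, h0]) h2
      · exact hδ k _ hDP ((hsplit _).le_right.trans (S _).2.2.1)
          ((hsplit _).variation_le_right.trans (S _).2.2.2) h2
    have h2 : ∑' i, (D i).toMeasure (K k) ≠ ⊤ := by
      have h3 := (hRY 0).le_right (K k)
      rw [hY 0, Measure.sum_apply _ (hK k).measurableSet] at h3
      simp only [zero_add] at h3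
      exact (h3.trans_lt (hK k).measure_lt_top).ne
    refine (ENNReal.finite_const_le_of_tsum_ne_top h2 (hδ0 k)).not_infinite ?_
    exact infinite_of_injective_forall_mem (f := fun i => Nat.pair k i)
      (fun i j h => (Nat.pair_eq_pair.1 h).2) h1
  have hR0 : R = 0 := by
    refine ext_toMeasure ?_
    rw [toMeasure_zero, ← Measure.measure_univ_eq_zero, ← union_compl_self (⋃ k, A k)]
    refine measure_union_null (measure_iUnion_null hRA) (le_antisymm ?_ zero_le)
    exact ((hRY 0).le_left _).trans hA.le
  have hVY : V = Y 0 := by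
    have h1 := (hRY 0).eq_add
    rwa [hR0, zero_add] at h1
  refine ⟨D, fun q => ?_, ?_, ?_⟩
  · rcases hG q (S q) with h0 | ⟨hDP, hD0, hDi⟩
    · exact Or.inl h0
    · have h1 := splits_sum_range hsplit 0 q
      rw [zero_add] at h1
      have h2 := h1.trans (hsplit q).symm
      exact Or.inr ⟨hDP, hD0, h2.le_left, ⟨_, h2.eq_add, h2.variation_eq⟩, hDi⟩
  · have h1 := hY 0
    simp only [zero_add] at h1
    rw [← h1, ← hVY]
  · refine variation_eq_sum hδV (fun q => ?_) ?_
    · rw [show V = (S 0).1 from rfl, variation_sum_range hsplit q]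
      exact Measure.le_add_right le_rfl
    · have h1 := hlim 0
      simp only [zero_add] at h1
      rwa [← hVY] at h1

theorem exists_isDecomposition_of_sequence {V : Varifold m U} (hδV : V.HasRadonVariation)
    {D : ℕ → Varifold m U} (hD : ∀ q, D q = 0 ∨ IsComponent P V (D q))
    (hVD : V.toMeasure = Measure.sum (fun i => (D i).toMeasure))
    (hvar : V.variation = Measure.sum (fun i => (D i).variation)) :
    ∃ (H : Set (Varifold m U)) (ξ : H → ℕ+), IsDecomposition P V H ξ := by
  -- A nonzero `W` charges some compact set, and `V` has finite mass there; so multiplicities are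
  -- finite.
  have hfin : ∀ W : Varifold m U, W ≠ 0 → {q | D q = W}.Finite := by
    intro W hW
    obtain ⟨K, hK, hWK⟩ : ∃ K : Set (U × Gr n m), IsCompact K ∧ W.toMeasure K ≠ 0 := by
      by_contra! h
      refine hW (ext_toMeasure ?_)
      rw [toMeasure_zero, ← Measure.measure_univ_eq_zero, ← iUnion_compactCovering]
      exact measure_iUnion_null fun i => h _ (isCompact_compactCovering _ i)
    have h1 : ∑' i, (D i).toMeasure K ≠ ⊤ := by
      rw [← Measure.sum_apply _ hK.measurableSet, ← hVD]
      exact hK.measure_lt_top.ne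
    refine (ENNReal.finite_const_le_of_tsum_ne_top h1 hWK).subset ?_
    intro q (hq : D q = W)
    change W.toMeasure K ≤ (D q).toMeasure K
    rw [hq]
  have hpos : ∀ x : {x | x ≠ 0 ∧ x ∈ range D}, 0 < {q | D q = x.1}.ncard := fun x =>
    (ncard_pos (hfin x x.2.1)).2 x.2.2
  refine ⟨{x | x ≠ 0 ∧ x ∈ range D}, fun x => ⟨_, hpos x⟩, ?_, ?_, fun k => ?_, fun f => ?_⟩
  · exact (countable_range D).mono fun x hx => hx.2
  · rintro _ ⟨h0, q, rfl⟩
    exact (hD q).resolve_left h0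
  · refine hasSum_nat_card_fiber_mul D hfin (fun x => {q | D q = x.1}.ncard) (fun _ => rfl)
      (fun W => ∫ p, k p ∂W.toMeasure) (integral_zero_measure _) ?_
    have hk := V.integrable_compactSupport k
    rw [hVD] at hk ⊢
    exact hasSum_integral_measure hk
  · refine hasSum_nat_card_fiber_mul D hfin (fun x => {q | D q = x.1}.ncard) (fun _ => rfl)
      (fun W => ∫ p, f p ∂W.variation) (by simp) ?_
    have : IsFiniteMeasureOnCompacts V.variation := hδV
    have hf : Integrable f V.variation :=
      f.continuous.integrable_of_hasCompactSupport f.hasCompactSupport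
    rw [hvar] at hf ⊢
    exact hasSum_integral_measure hf

end Varifold

/-! ### Upper densities and Hausdorff measure -/

section Density

/-- For each `k`, Vitali's lemma selects disjoint balls with `r ^ m < μ(B) / k` whose fivefold
enlargements cover `N`. Their diameters are at most `10 * r`, so the `m`-th powers sum to at most
`10 ^ m * μ K / k`. -/
theorem hausdorffMeasure_eq_zero_of_frequently_lt {X : Type*} [MetricSpace X]
    [SecondCountableTopology X] [MeasurableSpace X] [BorelSpace X] {m : ℕ} {μ : Measure X}
    {N K : Set X} (hμK : μ K ≠ ⊤) {k₀ : ℕ}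
    (hN : ∀ x ∈ N, Metric.closedBall x (1 / ((k₀ : ℝ) + 1)) ⊆ K)
    (h : ∀ x ∈ N, ∀ k : ℕ, ∃ r : ℝ, 0 < r ∧ r ≤ 1 / ((k : ℝ) + 1) ∧
      ENNReal.ofReal (k * r ^ m) < μ (Metric.closedBall x r)) :
    Measure.hausdorffMeasure (m : ℝ) N = 0 := by
  choose! r hr0 hrk hrμ using h
  have hcov : ∀ k : ℕ, ∃ u ⊆ N, (u.PairwiseDisjoint fun a => Metric.closedBall a (r a k)) ∧
      ∀ a ∈ N, ∃ b ∈ u, Metric.closedBall a (r a k) ⊆ Metric.closedBall b (5 * r b k) :=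
    fun k => Vitali.exists_disjoint_subfamily_covering_enlargement_closedBall N (fun x => x)
      (fun x => r x k) (1 / ((k : ℝ) + 1)) (fun x hx => hrk x hx k) 5 (by norm_num)
  choose u huN hudisj hucov using hcov
  have hcount : ∀ k, (u k).Countable := fun k =>
    (hudisj k).countable_of_nonempty_interior fun x hx =>
      ⟨x, mem_interior_iff_mem_nhds.2 (Metric.closedBall_mem_nhds x (hr0 x (huN k hx) k))⟩
  have : ∀ k, Countable (u k) := fun k => (hcount k).to_subtype
  have hdiam : ∀ k, ∀ x : u k, Metric.ediam (Metric.closedBall x.1 (5 * r x.1 k)) ≤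
      ENNReal.ofReal (10 * r x.1 k) := by
    intro k x
    refine Metric.ediam_le_of_forall_dist_le fun y hy z hz => ?_
    have := dist_triangle_right y z x.1
    rw [Metric.mem_closedBall] at hy hz
    linarith
  have hr1 : Tendsto (fun k : ℕ => ENNReal.ofReal (10 * (1 / ((k : ℝ) + 1)))) atTop (𝓝 0) := by
    have := ENNReal.tendsto_ofReal (tendsto_one_div_add_atTop_nhds_zero_nat.const_mul (10 : ℝ))
    simpa using this
  refine le_antisymm ?_ zero_le
  refine (Measure.hausdorffMeasure_le_liminf_tsum (m : ℝ) N
    (fun k : ℕ => ENNReal.ofReal (10 * (1 / ((k : ℝ) + 1)))) hr1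
    (fun k (x : u k) => Metric.closedBall x.1 (5 * r x.1 k))
    (Eventually.of_forall fun k x => (hdiam k x).trans (ENNReal.ofReal_le_ofReal
      (by linarith [hrk x.1 (huN k x.2) k])))
    (Eventually.of_forall fun k a ha => by
      obtain ⟨b, hb, hab⟩ := hucov k a ha
      exact mem_iUnion.2 ⟨⟨b, hb⟩, hab (Metric.mem_closedBall_self (hr0 a ha k).le)⟩)).trans ?_
  have hbound : ∀ᶠ k : ℕ in atTop,
      ∑' x : u k, Metric.ediam (Metric.closedBall x.1 (5 * r x.1 k)) ^ (m : ℝ) ≤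
        10 ^ m * μ K * (k : ℝ≥0∞)⁻¹ := by
    -- `k ≥ k₀` keeps the selected balls inside `K`, and `k ≥ 1` permits division by `k`.
    filter_upwards [eventually_ge_atTop (max k₀ 1)] with k hk
    have hk1 : (0 : ℝ) < k := by exact_mod_cast (le_max_right _ _).trans hk
    have hk0 : (k₀ : ℝ) ≤ k := by exact_mod_cast (le_max_left _ _).trans hk
    have hterm : ∀ x : u k, Metric.ediam (Metric.closedBall x.1 (5 * r x.1 k)) ^ (m : ℝ) ≤
        10 ^ m * (k : ℝ≥0∞)⁻¹ * μ (Metric.closedBall x.1 (r x.1 k)) := by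
      intro x
      have hx := huN k x.2
      rw [ENNReal.rpow_natCast]
      refine (pow_le_pow_left₀ zero_le (hdiam k x) m).trans ?_
      have h1 : ENNReal.ofReal (10 * r x.1 k) ^ m =
          10 ^ m * (k : ℝ≥0∞)⁻¹ * ENNReal.ofReal (k * r x.1 k ^ m) := by
        rw [ENNReal.ofReal_mul (by norm_num), mul_pow, ENNReal.ofReal_mul hk1.le,
          ENNReal.ofReal_natCast, ENNReal.ofReal_pow (hr0 x.1 hx k).le, mul_assoc, ← mul_assoc _ (k : ℝ≥0∞),
          ENNReal.inv_mul_cancel (by exact_mod_cast hk1.ne') (ENNReal.natCast_ne_top k), one_mul]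
        norm_num
      rw [h1]
      exact mul_le_mul_right (hrμ x.1 hx k).le _
    refine (ENNReal.tsum_le_tsum hterm).trans ?_
    rw [ENNReal.tsum_mul_left]
    have hsum : ∑' x : u k, μ (Metric.closedBall x.1 (r x.1 k)) ≤ μ K := by
      rw [← measure_biUnion (hcount k) (hudisj k) fun x _ => Metric.isClosed_closedBall.measurableSet]
      refine measure_mono (iUnion₂_subset fun x hx => ?_)
      refine (Metric.closedBall_subset_closedBall ((hrk x (huN k hx) k).trans ?_)).trans
        (hN x (huN k hx))
      gcongr
    calc _ ≤ 10 ^ m * (k : ℝ≥0∞)⁻¹ * μ K := mul_le_mul_right hsum _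
      _ = _ := by ring
  have hlim : Tendsto (fun k : ℕ => 10 ^ m * μ K * (k : ℝ≥0∞)⁻¹) atTop (𝓝 0) := by
    have := ENNReal.Tendsto.const_mul (a := 10 ^ m * μ K) ENNReal.tendsto_inv_nat_nhds_zero
      (Or.inr (by finiteness))
    rwa [mul_zero] at this
  exact (liminf_le_liminf hbound).trans hlim.liminf_eq.le

namespace Varifold

variable {m n : ℕ} {U : Opens (Eucl n)}

theorem weight_apply (V : Varifold m U) {A : Set U} (hA : MeasurableSet A) :
    V.weight A = V.toMeasure (A ×ˢ univ) := by
  rw [weight, Measure.map_apply measurable_fst hA, prod_univ]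

theorem weight_absolutelyContinuous_of_isRectifiable {V : Varifold m U} (hV : V.IsRectifiable) :
    V.weight ≪ Measure.hausdorffMeasure (m : ℝ) := by
  refine Measure.AbsolutelyContinuous.mk fun A hA h0 => ?_
  obtain ⟨c, E, -, -, h⟩ := hV
  rw [V.weight_apply hA, h _ (hA.prod MeasurableSet.univ), ENNReal.tsum_eq_zero]
  intro i
  have : setVarifold m (E i) (A ×ˢ (univ : Set (Gr n m))) = 0 := by
    refine measure_mono_null (t := A) ?_ (by simp [hausdorff, h0])
    rintro x ⟨-, S, -, hx⟩
    exact hx.1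
  rw [this, mul_zero]

end Varifold

end Density

/-! ### The monotonicity inequality -/

section Monotonicity

/-- A smooth decreasing function equal to `1` up to `1 / 4` and to `0` from `1 / 2` on. -/
def cutoff (u : ℝ) : ℝ := Real.smoothTransition (2 - 4 * u)

theorem contDiff_cutoff {k : ℕ∞} : ContDiff ℝ k cutoff :=
  Real.smoothTransition.contDiff.comp (by fun_prop)

theorem hasDerivAt_cutoff (u : ℝ) : HasDerivAt cutoff (deriv cutoff u) u :=
  ((contDiff_cutoff (k := 1)).differentiable (by simp) u).hasDerivAt

theorem continuous_deriv_cutoff : Continuous (deriv cutoff) :=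
  (contDiff_cutoff (k := 1)).continuous_deriv (by simp)

theorem cutoff_nonneg (u : ℝ) : 0 ≤ cutoff u := Real.smoothTransition.nonneg _

theorem cutoff_le_one (u : ℝ) : cutoff u ≤ 1 := Real.smoothTransition.le_one _

theorem cutoff_eq_one {u : ℝ} (hu : u ≤ 1 / 4) : cutoff u = 1 :=
  Real.smoothTransition.one_of_one_le (by linarith)

theorem cutoff_eq_zero {u : ℝ} (hu : 1 / 2 ≤ u) : cutoff u = 0 :=
  Real.smoothTransition.zero_of_nonpos (by linarith)

theorem antitone_cutoff : Antitone cutoff := fun u v h =>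
  Real.smoothTransition.monotone (by linarith)

theorem deriv_cutoff_nonpos (u : ℝ) : deriv cutoff u ≤ 0 := antitone_cutoff.deriv_nonpos

theorem deriv_cutoff_eq_zero {u : ℝ} (hu : 1 / 2 < u) : deriv cutoff u = 0 := by
  have : cutoff =ᶠ[𝓝 u] fun _ => 0 := by
    filter_upwards [lt_mem_nhds hu] with v hv using cutoff_eq_zero hv.le
  rw [this.deriv_eq, deriv_const]

/-- Supplies the dominating constant for differentiating `radialMass` under the integral. -/
theorem exists_abs_deriv_cutoff_mul_le : ∃ C : ℝ, 0 ≤ C ∧ ∀ u : ℝ, 0 ≤ u →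
    |deriv cutoff u * u| ≤ C := by
  obtain ⟨C, hC⟩ := (isCompact_Icc (a := (0 : ℝ)) (b := 1)).exists_bound_of_continuousOn
    (continuous_deriv_cutoff.mul continuous_id).continuousOn
  refine ⟨max C 0, le_max_right _ _, fun u hu => ?_⟩
  rcases le_or_gt u 1 with h1 | h1
  · exact (hC u ⟨hu, h1⟩).trans (le_max_left _ _)
  · rw [deriv_cutoff_eq_zero (by linarith), zero_mul, abs_zero]
    exact le_max_right _ _

variable {m n : ℕ} {U : Opens (Eucl n)}

theorem isCompact_closedBall_opens {a : U} {R : ℝ}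
    (hR : Metric.closedBall (a : Eucl n) R ⊆ U) : IsCompact (Metric.closedBall a R) := by
  refine IsEmbedding.subtypeVal.isCompact_iff.2 ?_
  have : (Subtype.val '' Metric.closedBall a R : Set (Eucl n)) = Metric.closedBall (a : Eucl n) R := by
    ext x
    constructor
    · rintro ⟨y, hy, rfl⟩
      exact hy
    · exact fun hx => ⟨⟨x, hR hx⟩, hx, rfl⟩
  rw [this]
  exact isCompact_closedBall _ _

theorem norm_lt_of_norm_sq_div_le {y : Eucl n} {r : ℝ} (hr : 0 < r)
    (h : ‖y‖ ^ 2 / r ^ 2 ≤ 1 / 2) : ‖y‖ < r := by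
  rw [div_le_iff₀ (by positivity)] at h
  refine lt_of_pow_lt_pow_left₀ 2 hr.le ?_
  nlinarith [pow_pos hr 2]

/-- This is the vector field of the monotonicity formula; using the squared norm keeps it smooth at
`a`. -/
theorem exists_radial_testFunction {a : U} {r : ℝ} (hr : 0 < r)
    (hrU : Metric.closedBall (a : Eucl n) r ⊆ U) :
    ∃ g : 𝓓(U, Eucl n), (∀ x, g x = cutoff (‖x - a‖ ^ 2 / r ^ 2) • (x - (a : Eucl n))) ∧
      tsupport g ⊆ Metric.ball (a : Eucl n) r := by
  have h1 : ContDiff ℝ ((⊤ : ℕ∞) : WithTop ℕ∞)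
      (fun x : Eucl n => cutoff (‖x - a‖ ^ 2 / r ^ 2) • (x - (a : Eucl n))) := by
    refine ContDiff.smul (contDiff_cutoff.comp ?_) (by fun_prop)
    exact ((contDiff_id.sub contDiff_const).norm_sq ℝ).div_const _
  have h2 : tsupport (fun x : Eucl n => cutoff (‖x - a‖ ^ 2 / r ^ 2) • (x - (a : Eucl n))) ⊆
      {x | ‖x - a‖ ^ 2 / r ^ 2 ≤ 1 / 2} := by
    refine closure_minimal (fun x hx => ?_) (isClosed_le (by fun_prop) continuous_const)
    by_contra hlt
    refine hx ?_
    rw [mem_ofPred_eq, not_le] at hlt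
    simp only [cutoff_eq_zero hlt.le, zero_smul]
  have h3 : {x : Eucl n | ‖x - a‖ ^ 2 / r ^ 2 ≤ 1 / 2} ⊆ Metric.ball (a : Eucl n) r :=
    fun x hx => by
      rw [mem_ball_iff_norm]
      exact norm_lt_of_norm_sq_div_le hr hx
  have h4 : HasCompactSupport
      (fun x : Eucl n => cutoff (‖x - a‖ ^ 2 / r ^ 2) • (x - (a : Eucl n))) :=
    (isCompact_closedBall (a : Eucl n) r).of_isClosed_subset (isClosed_tsupport _)
      ((h2.trans h3).trans Metric.ball_subset_closedBall)
  exact ⟨TestFunction.mk _ h1 h4 (((h2.trans h3).trans Metric.ball_subset_closedBall).trans hrU),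
    fun _ => rfl, h2.trans h3⟩

namespace Varifold

/-- The multiple of the identity contributes `trace S_♮ = m`; the derivative of the cutoff
contributes a rank one map, whose trace is an inner product. -/
theorem tangentialDivergence_radial {a : U} {r : ℝ} (g : 𝓓(U, Eucl n))
    (hg : ∀ x, g x = cutoff (‖x - a‖ ^ 2 / r ^ 2) • (x - (a : Eucl n))) (p : U × Gr n m) :
    tangentialDivergence g p = m * cutoff (‖(p.1 : Eucl n) - a‖ ^ 2 / r ^ 2) +
      deriv cutoff (‖(p.1 : Eucl n) - a‖ ^ 2 / r ^ 2) * (2 / r ^ 2) *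
        inner ℝ ((p.1 : Eucl n) - a) (p.2.proj ((p.1 : Eucl n) - a)) := by
  set y : Eucl n := (p.1 : Eucl n) - a with hy
  have h1 : HasFDerivAt (fun x : Eucl n => x - (a : Eucl n)) (ContinuousLinearMap.id ℝ _) p.1 :=
    (hasFDerivAt_id _).sub_const _
  have h2 : HasFDerivAt (fun x : Eucl n => ‖x - a‖ ^ 2 / r ^ 2)
      ((2 / r ^ 2) • (innerSL ℝ y : Eucl n →L[ℝ] ℝ)) p.1 := by
    have h := h1.norm_sq.mul_const ((r ^ 2)⁻¹)
    simp only [← div_eq_mul_inv] at h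
    refine h.congr_fderiv ?_
    ext v
    simp [hy]
    ring
  have h3 := (hasDerivAt_cutoff (‖y‖ ^ 2 / r ^ 2)).comp_hasFDerivAt (p.1 : Eucl n) h2
  have h4 : HasFDerivAt g (cutoff (‖y‖ ^ 2 / r ^ 2) • ContinuousLinearMap.id ℝ (Eucl n) +
      (deriv cutoff (‖y‖ ^ 2 / r ^ 2) • (2 / r ^ 2) • (innerSL ℝ y : Eucl n →L[ℝ] ℝ)).smulRight y)
      (p.1 : Eucl n) := by
    have h5 := h3.smul h1
    rw [show (g : Eucl n → Eucl n) = _ from funext hg]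
    exact h5
  have h6 : LinearMap.trace ℝ (Eucl n) (p.2.proj : Eucl n →ₗ[ℝ] Eucl n) = m := by
    rw [Gr.proj, Gr.trace_starProjection, p.2.2]
  have h7 : (((cutoff (‖y‖ ^ 2 / r ^ 2) • ContinuousLinearMap.id ℝ (Eucl n) +
      (deriv cutoff (‖y‖ ^ 2 / r ^ 2) • (2 / r ^ 2) •
        (innerSL ℝ y : Eucl n →L[ℝ] ℝ)).smulRight y) ∘L p.2.proj : Eucl n →L[ℝ] Eucl n) :
        Eucl n →ₗ[ℝ] Eucl n) =
      cutoff (‖y‖ ^ 2 / r ^ 2) • (p.2.proj : Eucl n →ₗ[ℝ] Eucl n) +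
        (((deriv cutoff (‖y‖ ^ 2 / r ^ 2) • (2 / r ^ 2) •
          (innerSL ℝ y : Eucl n →L[ℝ] ℝ)) ∘L p.2.proj : Eucl n →L[ℝ] ℝ) :
            Eucl n →ₗ[ℝ] ℝ).smulRight y := by
    ext v
    simp
  rw [tangentialDivergence, h4.fderiv, h7, map_add, map_smul, h6, LinearMap.trace_smulRight]
  simp only [ContinuousLinearMap.coe_coe, ContinuousLinearMap.comp_apply,
    smul_apply, innerSL_apply_apply, smul_eq_mul]
  ring

theorem inner_proj_le (S : Gr n m) (y : Eucl n) : inner ℝ y (S.proj y) ≤ ‖y‖ ^ 2 := by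
  refine (real_inner_le_norm _ _).trans ?_
  have h : ‖S.proj y‖ ≤ ‖y‖ := by
    simpa using (S.proj.le_of_opNorm_le (Submodule.starProjection_norm_le S.1) y)
  nlinarith [norm_nonneg y]

/-- As the cutoff decreases, `y • S_♮ y ≤ |y|²` bounds the rank one term from below. The left side
no longer involves the plane, and integrates to `m * I - r * I'` for `I = radialMass`. -/
theorem le_tangentialDivergence_radial {a : U} {r : ℝ} (g : 𝓓(U, Eucl n))
    (hg : ∀ x, g x = cutoff (‖x - a‖ ^ 2 / r ^ 2) • (x - (a : Eucl n))) (p : U × Gr n m) :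
    m * cutoff (‖(p.1 : Eucl n) - a‖ ^ 2 / r ^ 2) +
      deriv cutoff (‖(p.1 : Eucl n) - a‖ ^ 2 / r ^ 2) *
        (2 * (‖(p.1 : Eucl n) - a‖ ^ 2 / r ^ 2)) ≤ tangentialDivergence g p := by
  rw [tangentialDivergence_radial g hg]
  have h1 := mul_le_mul_of_nonneg_left (inner_proj_le p.2 ((p.1 : Eucl n) - a))
    (show 0 ≤ 2 / r ^ 2 by positivity)
  have h2 := mul_le_mul_of_nonpos_left h1
    (deriv_cutoff_nonpos (‖(p.1 : Eucl n) - a‖ ^ 2 / r ^ 2))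
  have h3 : 2 / r ^ 2 * ‖(p.1 : Eucl n) - a‖ ^ 2 = 2 * (‖(p.1 : Eucl n) - a‖ ^ 2 / r ^ 2) := by
    ring
  rw [h3, ← mul_assoc] at h2
  linarith

/-- `∫ χ(|x - a|² / r²) d‖W‖ x`, a smooth approximation of the mass in a ball. -/
def radialMass (W : Varifold m U) (a : U) (r : ℝ) : ℝ :=
  ∫ p, cutoff (‖(p.1 : Eucl n) - a‖ ^ 2 / r ^ 2) ∂W.toMeasure

theorem firstVariation_radial_le (W : Varifold m U) {a : U} {r : ℝ} (hr : 0 < r)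
    (g : 𝓓(U, Eucl n)) (hg : ∀ x, g x = cutoff (‖x - a‖ ^ 2 / r ^ 2) • (x - (a : Eucl n)))
    (hgs : tsupport g ⊆ Metric.ball (a : Eucl n) r) {M : ℝ} (hM0 : 0 ≤ M)
    (hM : W.variation (Metric.closedBall a r) ≤ ENNReal.ofReal M) :
    W.firstVariation g ≤ r * M := by
  have h1 : ENNReal.ofReal (W.firstVariation (r⁻¹ • g)) ≤
      openVariation W.firstVariation (Metric.ball a r) := by
    refine le_openVariation _ _ ?_ fun x => ?_
    · refine (closure_mono ?_ : tsupport (r⁻¹ • g : 𝓓(U, Eucl n)) ⊆ tsupport g).trans ?_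
      · intro x hx h0
        exact hx (show r⁻¹ • g x = 0 by rw [h0, smul_zero])
      · intro x hx
        exact ⟨⟨x, g.tsupport_subset hx⟩, hgs hx, rfl⟩
    · change ‖r⁻¹ • g x‖ ≤ 1
      rw [norm_smul, norm_inv, Real.norm_of_nonneg hr.le, inv_mul_le_iff₀ hr, mul_one]
      by_cases hx : g x = 0
      · rw [hx, norm_zero]
        exact hr.le
      · have hx' : x ∈ tsupport g := subset_tsupport _ hx
        have hxr := mem_ball_iff_norm.1 (hgs hx')
        rw [hg, norm_smul, Real.norm_of_nonneg (cutoff_nonneg _)]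
        exact (mul_le_of_le_one_left (norm_nonneg _) (cutoff_le_one _)).trans hxr.le
  have h2 : openVariation W.firstVariation (Metric.ball a r) ≤ ENNReal.ofReal M := by
    rw [← totalVariation_open _ Metric.isOpen_ball]
    exact (measure_mono Metric.ball_subset_closedBall).trans hM
  have h3 := (ENNReal.ofReal_le_ofReal_iff hM0).1 (h1.trans h2)
  rw [map_smul, smul_eq_mul, inv_mul_le_iff₀ hr] at h3
  exact h3

theorem hasDerivAt_radialMass (W : Varifold m U) {a : U} {r R : ℝ} (hr : 0 < r) (hrR : r < R)
    (hR : Metric.closedBall (a : Eucl n) R ⊆ U) :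
    Integrable (fun p : U × Gr n m => cutoff (‖(p.1 : Eucl n) - a‖ ^ 2 / r ^ 2)) W.toMeasure ∧
    Integrable (fun p : U × Gr n m => deriv cutoff (‖(p.1 : Eucl n) - a‖ ^ 2 / r ^ 2) *
      (-2 / r * (‖(p.1 : Eucl n) - a‖ ^ 2 / r ^ 2))) W.toMeasure ∧
    HasDerivAt (W.radialMass a) (∫ p, deriv cutoff (‖(p.1 : Eucl n) - a‖ ^ 2 / r ^ 2) *
      (-2 / r * (‖(p.1 : Eucl n) - a‖ ^ 2 / r ^ 2)) ∂W.toMeasure) r := by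
  obtain ⟨C, hC0, hC⟩ := exists_abs_deriv_cutoff_mul_le
  have hK : IsCompact (Metric.closedBall a R ×ˢ (univ : Set (Gr n m))) :=
    (isCompact_closedBall_opens hR).prod isCompact_univ
  have hcont : ∀ s : ℝ, Continuous fun p : U × Gr n m =>
      cutoff (‖(p.1 : Eucl n) - a‖ ^ 2 / s ^ 2) := fun s =>
    (contDiff_cutoff (k := 1)).continuous.comp (by fun_prop)
  have hout : ∀ s ∈ Ioo (r / 2) R, ∀ p : U × Gr n m,
      p ∉ Metric.closedBall a R ×ˢ (univ : Set (Gr n m)) →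
      1 / 2 < ‖(p.1 : Eucl n) - a‖ ^ 2 / s ^ 2 := by
    intro s hs p hp
    have hs0 : 0 < s := by linarith [hs.1]
    by_contra hle
    refine hp ⟨?_, mem_univ _⟩
    have := norm_lt_of_norm_sq_div_le hs0 (not_lt.1 hle)
    rw [Metric.mem_closedBall, Subtype.dist_eq, dist_eq_norm]
    linarith [hs.2]
  have hr' : r ∈ Ioo (r / 2) R := ⟨by linarith, hrR⟩
  have hint : Integrable (fun p : U × Gr n m => cutoff (‖(p.1 : Eucl n) - a‖ ^ 2 / r ^ 2))
      W.toMeasure :=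
    (hcont r).integrable_of_hasCompactSupport (HasCompactSupport.intro hK fun p hp =>
      cutoff_eq_zero (hout r hr' p hp).le)
  refine ⟨hint, ?_⟩
  refine hasDerivAt_integral_of_dominated_loc_of_deriv_le (s := Ioo (r / 2) R)
    (F := fun s p => cutoff (‖((p : U × Gr n m).1 : Eucl n) - a‖ ^ 2 / s ^ 2))
    (F' := fun s p => deriv cutoff (‖(p.1 : Eucl n) - a‖ ^ 2 / s ^ 2) *
      (-2 / s * (‖(p.1 : Eucl n) - a‖ ^ 2 / s ^ 2)))
    -- For `s > r / 2` the factor `2 / s` is at most `4 / r`, and for `s < R` the integrand vanishes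
    -- off the ball of radius `R`.
    (bound := (Metric.closedBall a R ×ˢ (univ : Set (Gr n m))).indicator fun _ => C * (4 / r))
    (Ioo_mem_nhds hr'.1 hr'.2) (Eventually.of_forall fun s => (hcont s).aestronglyMeasurable)
    hint ?_ ?_ ?_ ?_
  · refine Continuous.aestronglyMeasurable ?_
    exact (continuous_deriv_cutoff.comp (by fun_prop)).mul (by fun_prop)
  · refine Eventually.of_forall fun p s hs => ?_
    have hs0 : 0 < s := by linarith [hs.1]
    by_cases hp : p ∈ Metric.closedBall a R ×ˢ (univ : Set (Gr n m))
    · rw [indicator_of_mem hp]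
      set u := ‖(p.1 : Eucl n) - a‖ ^ 2 / s ^ 2 with hu
      have h1 : deriv cutoff u * (-2 / s * u) = (deriv cutoff u * u) * (-2 / s) := by ring
      rw [h1, Real.norm_eq_abs, abs_mul]
      refine mul_le_mul (hC u (by positivity)) ?_ (abs_nonneg _) hC0
      rw [abs_div, abs_neg, abs_two, abs_of_pos hs0, div_le_div_iff₀ hs0 hr]
      linarith [hs.1]
    · rw [indicator_of_notMem hp, deriv_cutoff_eq_zero (hout s hs p hp), zero_mul, norm_zero]
  · exact (integrable_indicator_iff hK.measurableSet).2 (integrableOn_const hK.measure_lt_top.ne)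
  · refine Eventually.of_forall fun p s hs => ?_
    have hs0 : s ≠ 0 := by linarith [hs.1]
    have h1 : HasDerivAt (fun s : ℝ => ‖(p.1 : Eucl n) - a‖ ^ 2 / s ^ 2)
        (-2 / s * (‖(p.1 : Eucl n) - a‖ ^ 2 / s ^ 2)) s := by
      have := ((hasDerivAt_pow 2 s).inv (pow_ne_zero 2 hs0)).const_mul (‖(p.1 : Eucl n) - a‖ ^ 2)
      simp only [Pi.inv_apply, ← div_eq_mul_inv] at this
      refine this.congr_deriv ?_
      field_simp
      simp only [Nat.cast_ofNat, Nat.add_one_sub_one, pow_one]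
      ring
    exact (hasDerivAt_cutoff _).comp s h1

end Varifold

end Monotonicity

/-! ### Lower mass bounds -/

namespace Varifold

variable {m n : ℕ} {U : Opens (Eucl n)}

/-- With `I = radialMass`, testing the first variation gives `m * I - r * I' ≤ δW(g) ≤ r * (k * r ^
m)`. Division by `r * r ^ m` shows that the derivative of `r⁻ᵐ I + k r` is nonnegative. -/
theorem monotoneOn_radialMass (W : Varifold m U) {a : U} {R k : ℝ} (hk : 0 ≤ k)
    (hR : Metric.closedBall (a : Eucl n) R ⊆ U)
    (hvar : ∀ r, 0 < r → r ≤ R → W.variation (Metric.closedBall a r) ≤ ENNReal.ofReal (k * r ^ m)) :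
    MonotoneOn (fun r => (r ^ m)⁻¹ * W.radialMass a r + k * r) (Ioo 0 R) := by
  have hderiv : ∀ r ∈ Ioo 0 R, ∃ d : ℝ, 0 ≤ d ∧
      HasDerivAt (fun r => (r ^ m)⁻¹ * W.radialMass a r + k * r) d r := by
    rintro r ⟨hr, hrR⟩
    obtain ⟨h1, h2, h3⟩ := W.hasDerivAt_radialMass hr hrR hR
    obtain ⟨g, hg, hgs⟩ := exists_radial_testFunction hr
      ((Metric.closedBall_subset_closedBall hrR.le).trans hR)
    have h4 := W.firstVariation_radial_le hr g hg hgs (by positivity : 0 ≤ k * r ^ m)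
      (hvar r hr hrR.le)
    set I' := ∫ p, deriv cutoff (‖(p.1 : Eucl n) - a‖ ^ 2 / r ^ 2) *
      (-2 / r * (‖(p.1 : Eucl n) - a‖ ^ 2 / r ^ 2)) ∂W.toMeasure with hI'
    have h5 : m * W.radialMass a r - r * I' ≤ W.firstVariation g := by
      rw [radialMass, hI', ← integral_const_mul, ← integral_const_mul,
        ← integral_sub (h1.const_mul _) (h2.const_mul _)]
      refine integral_mono ((h1.const_mul _).sub (h2.const_mul _))
        (W.integrable_tangentialDivergence g) fun p => ?_
      refine le_trans (le_of_eq ?_) (le_tangentialDivergence_radial g hg p)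
      field_simp
      ring
    have h6 := (((hasDerivAt_pow m r).inv (pow_ne_zero m hr.ne')).mul h3).add
      ((hasDerivAt_id r).const_mul k)
    refine ⟨_, ?_, h6⟩
    have hrm : 0 < r ^ m := by positivity
    have h7 : m * W.radialMass a r - r * I' ≤ r * (k * r ^ m) := h5.trans h4
    have h8 : (-(m * r ^ (m - 1)) / (r ^ m) ^ 2) * W.radialMass a r + (r ^ m)⁻¹ * I' + k * 1 =
        (r * (k * r ^ m) - (m * W.radialMass a r - r * I')) / (r * r ^ m) := by
      -- The exponent is truncated at `m = 0`, where the factor `m` makes both sides vanish.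
      have h9 : (m : ℝ) * r ^ (m - 1) * r = m * r ^ m := by
        rcases m with _ | m
        · simp
        · rw [mul_assoc, ← pow_succ, Nat.add_sub_cancel]
      have h10 : (m : ℝ) * r ^ (m - 1) = m * r ^ m / r := by
        rw [← h9, mul_div_cancel_right₀ _ hr.ne']
      rw [h10]
      field_simp
      ring
    refine le_trans ?_ h8.ge
    exact div_nonneg (by linarith) (by positivity)
  refine monotoneOn_of_deriv_nonneg (convex_Ioo 0 R) (fun r hr => ?_) (fun r hr => ?_)
    fun r hr => ?_
  · obtain ⟨d, -, hd⟩ := hderiv r hr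
    exact hd.continuousAt.continuousWithinAt
  · obtain ⟨d, -, hd⟩ := hderiv r (interior_subset hr)
    exact hd.differentiableAt.differentiableWithinAt
  · obtain ⟨d, hd0, hd⟩ := hderiv r (interior_subset hr)
    rwa [hd.deriv]

instance (V : Varifold m U) : IsFiniteMeasureOnCompacts V.weight :=
  ⟨fun K hK => by
    rw [V.weight_apply hK.measurableSet]
    exact (hK.prod isCompact_univ).measure_lt_top⟩

theorem radialMass_le_weight (W : Varifold m U) {a : U} {r R : ℝ} (hr : 0 < r) (hrR : r < R)
    (hR : Metric.closedBall (a : Eucl n) R ⊆ U) :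
    W.radialMass a r ≤ (W.weight (Metric.closedBall a r)).toReal := by
  have hK := (isCompact_closedBall_opens
    ((Metric.closedBall_subset_closedBall hrR.le).trans hR)).prod (isCompact_univ (X := Gr n m))
  rw [W.weight_apply Metric.isClosed_closedBall.measurableSet, ← Measure.real_def,
    ← integral_indicator_one hK.measurableSet]
  refine integral_mono (W.hasDerivAt_radialMass hr hrR hR).1
    ((integrable_indicator_iff hK.measurableSet).2 (integrableOn_const hK.measure_lt_top.ne))
    fun p => ?_
  by_cases hp : p ∈ Metric.closedBall a r ×ˢ (univ : Set (Gr n m))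
  · rw [indicator_of_mem hp]
    exact cutoff_le_one _
  · rw [indicator_of_notMem hp]
    refine (cutoff_eq_zero (not_lt.1 fun h => hp ⟨?_, mem_univ _⟩)).le
    rw [Metric.mem_closedBall, Subtype.dist_eq, dist_eq_norm]
    exact (norm_lt_of_norm_sq_div_le hr h.le).le

theorem weight_le_radialMass (W : Varifold m U) {a : U} {r R : ℝ} (hr : 0 < r) (hrR : r < R)
    (hR : Metric.closedBall (a : Eucl n) R ⊆ U) :
    (W.weight (Metric.closedBall a (r / 2))).toReal ≤ W.radialMass a r := by
  have hK := (isCompact_closedBall_opens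
    ((Metric.closedBall_subset_closedBall (by linarith : r / 2 ≤ R)).trans hR)).prod
      (isCompact_univ (X := Gr n m))
  rw [W.weight_apply Metric.isClosed_closedBall.measurableSet, ← Measure.real_def,
    ← integral_indicator_one hK.measurableSet]
  refine integral_mono ((integrable_indicator_iff hK.measurableSet).2
    (integrableOn_const hK.measure_lt_top.ne)) (W.hasDerivAt_radialMass hr hrR hR).1 fun p => ?_
  by_cases hp : p ∈ Metric.closedBall a (r / 2) ×ˢ (univ : Set (Gr n m))
  · have h1 := hp.1
    rw [Metric.mem_closedBall, Subtype.dist_eq, dist_eq_norm] at h1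
    have h2 : ‖(p.1 : Eucl n) - a‖ ^ 2 / r ^ 2 ≤ 1 / 4 := by
      rw [div_le_iff₀ (by positivity)]
      nlinarith [norm_nonneg ((p.1 : Eucl n) - a)]
    rw [indicator_of_mem hp, cutoff_eq_one h2]
    exact le_rfl
  · rw [indicator_of_notMem hp]
    exact cutoff_nonneg _

theorem ballVolume_pos (m : ℕ) : 0 < (ballVolume m).toReal :=
  ENNReal.toReal_pos (Metric.measure_ball_pos volume _ one_pos).ne' measure_ball_lt_top.ne

/-- A lower bound for the mass in balls at points of density at least `1` near which the first
variation is controlled. -/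
theorem le_weight_closedBall (W : Varifold m U) {a : U} {R k : ℝ} (hk : 0 ≤ k)
    (hR : Metric.closedBall (a : Eucl n) R ⊆ U)
    (hvar : ∀ r, 0 < r → r ≤ R → W.variation (Metric.closedBall a r) ≤ ENNReal.ofReal (k * r ^ m))
    {t : ℝ≥0∞} (ht : 1 ≤ t) (hdens : HasDensity m W.weight a t) {r : ℝ} (hr : r ∈ Ioo 0 R) :
    ENNReal.ofReal (r ^ m * ((ballVolume m).toReal / 2 ^ (m + 1) - k * r)) ≤
      W.weight (Metric.closedBall a r) := by
  have hα := ballVolume_pos m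
  have hmono := W.monotoneOn_radialMass hk hR hvar
  -- Settling for density ratio `1 / 2` leaves room to find an actual small radius `s`.
  have hhalf : (1 / 2 : ℝ≥0∞) < t := lt_of_lt_of_le (by simp) ht
  have h1 : ∀ᶠ s : ℝ in 𝓝[>] 0, (1 / 2 : ℝ≥0∞) <
      W.weight (Metric.closedBall a s) / (ballVolume m * ENNReal.ofReal s ^ m) :=
    hdens.eventually (lt_mem_nhds hhalf)
  obtain ⟨s, hs1, hs2⟩ := (h1.and (Ioo_mem_nhdsGT (show (0 : ℝ) < r / 2 by linarith [hr.1]))).exists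
  have hs0 : 0 < s := hs2.1
  have hsr : 2 * s < r := by linarith [hs2.2]
  have hfin : W.weight (Metric.closedBall a s) ≠ ⊤ :=
    (isCompact_closedBall_opens ((Metric.closedBall_subset_closedBall
      (by linarith [hr.2])).trans hR)).measure_lt_top.ne
  have h2 : (ballVolume m).toReal * s ^ m / 2 ≤ (W.weight (Metric.closedBall a s)).toReal := by
    have hden : ballVolume m * ENNReal.ofReal s ^ m =
        ENNReal.ofReal ((ballVolume m).toReal * s ^ m) := by
      rw [ENNReal.ofReal_mul hα.le, ENNReal.ofReal_pow hs0.le, ENNReal.ofReal_toReal]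
      exact measure_ball_lt_top.ne
    rw [hden, ← ENNReal.ofReal_toReal hfin, ← ENNReal.ofReal_div_of_pos (by positivity),
      show (1 / 2 : ℝ≥0∞) = ENNReal.ofReal (1 / 2) by
        rw [ENNReal.ofReal_div_of_pos two_pos]; simp] at hs1
    have := (ENNReal.ofReal_lt_ofReal_iff'.1 hs1).1
    rw [lt_div_iff₀ (by positivity)] at this
    linarith
  have h3 := W.weight_le_radialMass (r := 2 * s) (by linarith) (hsr.trans hr.2) hR
  rw [mul_div_cancel_left₀ s two_ne_zero] at h3
  have h4 := hmono ⟨by linarith, hsr.trans hr.2⟩ hr hsr.le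
  simp only at h4
  -- One factor `2` comes from the ratio `1 / 2`, the others from passing from radius `s` to `2 *
  -- s`.
  have h5 : (ballVolume m).toReal / 2 ^ (m + 1) ≤ ((2 * s) ^ m)⁻¹ * W.radialMass a (2 * s) := by
    rw [le_inv_mul_iff₀ (by positivity)]
    refine le_trans (le_of_eq ?_) (h2.trans h3)
    rw [mul_pow, pow_succ]
    field_simp
  have h6 : r ^ m * ((ballVolume m).toReal / 2 ^ (m + 1) - k * r) ≤ W.radialMass a r := by
    have hrm : 0 < r ^ m := pow_pos hr.1 m
    rw [← le_inv_mul_iff₀ hrm]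
    have : 0 ≤ k * (2 * s) := by positivity
    linarith
  exact ENNReal.ofReal_le_of_le_toReal (h6.trans (W.radialMass_le_weight hr.1 hr.2 hR))

/-! ### Sets of controlled first variation and the uniform mass bound. -/

theorem exists_closedBall_subset_exhaustion (E : CompactExhaustion U) (x : U) :
    ∃ k : ℕ, Metric.closedBall (x : Eucl n) (1 / ((k : ℝ) + 1)) ⊆ U ∧
      Metric.closedBall x (1 / ((k : ℝ) + 1)) ⊆ E k := by
  obtain ⟨ε, hε, h1⟩ := Metric.isOpen_iff.1 U.isOpen x x.2
  have h2 : Metric.closedBall (x : Eucl n) (ε / 2) ⊆ U :=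
    (Metric.closedBall_subset_ball (by linarith)).trans h1
  obtain ⟨i, hi⟩ := E.exists_superset_of_isCompact (isCompact_closedBall_opens h2)
  obtain ⟨j, hj⟩ := exists_nat_one_div_lt (half_pos hε)
  have hle : 1 / (((max i j : ℕ) : ℝ) + 1) ≤ ε / 2 := by
    refine le_trans ?_ hj.le
    gcongr
    exact le_max_right i j
  exact ⟨max i j, (Metric.closedBall_subset_closedBall hle).trans h2,
    ((Metric.closedBall_subset_closedBall hle).trans hi).trans (E.subset (le_max_left i j))⟩

/-- The points at distance at least `1 / (k + 1)` from the complement of the `k`-th compact set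
near which the first variation has `m`-dimensional density ratios at most `k`. -/
def controlledSet (V : Varifold m U) (E : CompactExhaustion U) (k : ℕ) : Set U :=
  {x | Metric.closedBall (x : Eucl n) (1 / ((k : ℝ) + 1)) ⊆ U ∧
    Metric.closedBall x (1 / ((k : ℝ) + 1)) ⊆ E k ∧
    ∀ r : ℝ, 0 < r → r ≤ 1 / ((k : ℝ) + 1) →
      V.variation (Metric.closedBall x r) ≤ ENNReal.ofReal (k * r ^ m)}

theorem weight_compl_iUnion_controlledSet {V : Varifold m U} (hV : V.IsRectifiable)
    (hδV : V.HasRadonVariation) (E : CompactExhaustion U) :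
    V.weight (⋃ k, V.controlledSet E k)ᶜ = 0 := by
  refine weight_absolutelyContinuous_of_isRectifiable hV ?_
  have hsub : (⋃ k, V.controlledSet E k)ᶜ ⊆ ⋃ k₀ : ℕ,
      (⋃ k, V.controlledSet E k)ᶜ ∩ {x | Metric.closedBall (x : Eucl n) (1 / ((k₀ : ℝ) + 1)) ⊆ U ∧
        Metric.closedBall x (1 / ((k₀ : ℝ) + 1)) ⊆ E k₀} := fun x hx => by
    obtain ⟨k, hk⟩ := exists_closedBall_subset_exhaustion E x
    exact mem_iUnion.2 ⟨k, hx, hk⟩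
  refine measure_mono_null hsub (measure_iUnion_null fun k₀ => ?_)
  have : IsFiniteMeasureOnCompacts V.variation := hδV
  refine hausdorffMeasure_eq_zero_of_frequently_lt (μ := V.variation) (K := E k₀)
    (E.isCompact k₀).measure_lt_top.ne (fun x hx => hx.2.2) ?_
  rintro x ⟨hx, hx1, hx2⟩ k
  by_contra! hcon
  -- The index `k₀` provides the two inclusions and `k` the density bound; all three conditions
  -- persist when the index grows.
  refine hx (mem_iUnion.2 ⟨max k k₀, ?_, ?_, fun r hr hr' => ?_⟩)
  · refine (Metric.closedBall_subset_closedBall ?_).trans hx1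
    gcongr
    exact le_max_right k k₀
  · refine ((Metric.closedBall_subset_closedBall ?_).trans hx2).trans (E.subset (le_max_right k k₀))
    gcongr
    exact le_max_right k k₀
  · refine (hcon r hr (hr'.trans ?_)).trans (ENNReal.ofReal_le_ofReal ?_)
    · gcongr
      exact le_max_left k k₀
    · gcongr
      exact le_max_left k k₀

/-- Control of `‖δV‖` at a point passes to every `W` with `‖δW‖ ≤ ‖δV‖`, and the radius is chosen
from `k` and `m` alone, so one `δ` serves all such `W`. -/
theorem exists_mass_lower_bound (V : Varifold m U) (E : CompactExhaustion U) (k : ℕ) :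
    ∃ δ : ℝ≥0∞, δ ≠ 0 ∧ ∀ W : Varifold m U, W.variation ≤ V.variation →
      (∀ᵐ x ∂W.weight, ∃ t : ℝ≥0∞, 1 ≤ t ∧ HasDensity m W.weight x t) →
      W.weight (V.controlledSet E k) ≠ 0 → δ ≤ W.weight (E k) := by
  have hα := ballVolume_pos m
  set β : ℝ := (ballVolume m).toReal / 2 ^ (m + 1) with hβ
  have hβ0 : 0 < β := by positivity
  set R : ℝ := 1 / ((k : ℝ) + 1) with hR
  have hR0 : 0 < R := by positivity
  obtain ⟨r, hr0, hrR, hkr⟩ : ∃ r : ℝ, 0 < r ∧ r < R ∧ k * r < β := by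
    refine ⟨min (R / 2) (β / (2 * (k + 1))), by positivity, ?_, ?_⟩
    · exact (min_le_left _ _).trans_lt (half_lt_self hR0)
    · calc (k : ℝ) * min (R / 2) (β / (2 * (k + 1))) ≤ k * (β / (2 * (k + 1))) := by
            gcongr
            exact min_le_right _ _
        _ < β := by
            rw [← mul_div_assoc, div_lt_iff₀ (by positivity)]
            nlinarith [(Nat.cast_nonneg k : (0 : ℝ) ≤ k)]
  refine ⟨ENNReal.ofReal (r ^ m * (β - k * r)), ?_, fun W hWV hdens hW => ?_⟩
  · rw [Ne, ENNReal.ofReal_eq_zero, not_le]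
    exact mul_pos (pow_pos hr0 m) (by linarith)
  · obtain ⟨x, hx, t, ht, hxt⟩ := (frequently_ae_mem_iff.2 hW).and_eventually hdens |>.exists
    refine (W.le_weight_closedBall (Nat.cast_nonneg k) hx.1
      (fun s hs hs' => (hWV _).trans (hx.2.2 s hs hs')) ht hxt ⟨hr0, hrR⟩).trans ?_
    exact measure_mono ((Metric.closedBall_subset_closedBall hrR.le).trans hx.2.1)

/-- The inequality needs no measurability of `A`, so it applies directly to `controlledSet`. -/
theorem toMeasure_prod_univ_le_weight (V : Varifold m U) (A : Set U) :
    V.toMeasure (A ×ˢ univ) ≤ V.weight A := by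
  rw [prod_univ]
  exact Measure.le_map_apply measurable_fst.aemeasurable A

end Varifold

end

theorem mainTheorem1 {m n : ℕ} (hm : 1 ≤ m) (hmn : m ≤ n) (U : TopologicalSpace.Opens (Eucl n))
    (P : Set (Varifold m U)) (hP : Varifold.IsAppropriate P)
    (V : Varifold m U) (hV : V ∈ P) (hδV : V.HasRadonVariation) :
    ∃ (H : Set (Varifold m U)) (ξ : H → ℕ+), Varifold.IsDecomposition P V H ξ := by
  let E : CompactExhaustion U := CompactExhaustion.choice U
  choose δ hδ0 hδ using V.exists_mass_lower_bound E
  have hA : V.toMeasure (⋃ k, V.controlledSet E k ×ˢ univ)ᶜ = 0 := by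
    rw [← iUnion_prod_const, prod_univ, ← preimage_compl, ← prod_univ]
    exact le_antisymm ((V.toMeasure_prod_univ_le_weight _).trans
      (Varifold.weight_compl_iUnion_controlledSet (hP.isRectifiable V hV) hδV E).le) zero_le
  obtain ⟨D, hD, hVD, hvar⟩ := Varifold.exists_sequence_of_isIndecomposable hP hV hδV
    (fun k => V.controlledSet E k ×ˢ univ) (fun k => E k ×ˢ univ) δ
    (fun k => (E.isCompact k).prod isCompact_univ) hδ0 hA fun k W hW _ hWV hWA => by
      rw [← W.weight_apply (E.isCompact k).measurableSet]
      refine hδ k W hWV (hP.one_le_density W hW) fun h => hWA ?_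
      exact le_antisymm ((W.toMeasure_prod_univ_le_weight _).trans h.le) zero_le
  exact Varifold.exists_isDecomposition_of_sequence hδV hD hVD hvar
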